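/- **Setting.** Let $f,h:\mathbb{R}^n\to\mathbb{R}$ and $\omega:\mathbb{R}^n\to(-\infty,\infty]$, put $\bar h=h+\omega$, $\bar h^*=\inf\bar h$, $X^*=\arg\min\bar h$, and consider $\min f(x)$ subject to $x\in X^*$. Assume, with constants $L_f,L_h,\alpha>0$: $f$ is $L_f$-smooth (differentiable with $L_f$-Lipschitz gradient), possibly nonconvex, and $\inf f>-\infty$; $h$ is convex and $L_h$-smooth; $\omega$ is proper, closed and convex; $X^*$ is nonempty and bounded; and $\bar h(x)-\bar h^*\ge\alpha\,\mathrm{dist}^2(x,X^*)$ for all $x$ (quadratic growth). Let $\Pi_S$ be the Euclidean projection onto $S$. **Algorithm (IPR-VFISTA$_{nc}$).** Fix $\hat x_0,\,x_{0,0}\in\mathbb{R}^n$, a nonempty bounded closed box $\mathcal B$, $\bar\eta>0$ and a real $a\ge2$. Let $J_k=(k+1)^a$ (rounded up to an integer if necessary), $\eta_k=16(L_h+\bar\eta)\left(\frac{\ln J_k}{J_k}\right)^2$, $\gamma_k=\frac1{L_h+\eta_k}$, $\kappa_k=\frac{L_h+\eta_k}{\eta_k}$. Call an integer $K\ge1$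 admissible if $\hat\gamma:=1/\sqrt K\le 1/(2L_f)$. The run with $K$ outer iterations is, for $k=0,\dots,K-1$: $z_k=\hat x_k-\hat\gamma\nabla f(\hat x_k)$, $y_{k,0}=x_{k,0}$; for $j=0,\dots,J_k-1$, $$x_{k,j+1}=\mathrm{prox}_{\gamma_k\omega}\big[y_{k,j}-\gamma_k(\nabla h(y_{k,j})+\eta_k(y_{k,j}-z_k))\big],\qquad y_{k,j+1}=x_{k,j+1}+\tfrac{\sqrt{\kappa_k}-1}{\sqrt{\kappa_k}+1}(x_{k,j+1}-x_{k,j});$$ then $\hat x_{k+1}=x_{k,J_k}$ and $x_{k+1,0}=\Pi_{\mathcal B}[x_{k,J_k}]$. (For $k=0$, $J_0=1$ and $\eta_0=0$; the undefined $\kappa_0$ only enters the unused $y_{0,1}$.) **Notation.** $G_{1/\hat\gamma}(x)=\frac1{\hat\gamma}(x-\Pi_{X^*}[x-\hat\gamma\nabla f(x)])$; $\|G_{1/\hat\gamma}(\hat x_K^*)\|=\min_{\lfloor K/2\rfloor\le k\le K-1}\|G_{1/\hat\gamma}(\hat x_k)\|$; $f_{s,k}(x)=\frac12\|x-z_k\|^2$;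 $\hat C_f=\inf f$; $B_f=\sup_{\mathcal B\cup X^*}\|\nabla f\|$. Further $T_{1,k}=(L_h+\bar\eta)\big(f_{s,k}(x_{k,0})+\frac12\mathrm{dist}^2(x_{k,0},X^*)\big)$, $T_{2,k}=\bar h(x_{k,0})-\bar h^*$, $T_{3,k}=(L_h+\bar\eta)f_{s,k}(\Pi_{X^*}[x_{k,0}])$, $T_{4,k}=2\big(f_{s,k}(x_{k,0})+\frac12\|x_{k,0}-\Pi_{X^*}[z_k]\|^2\big)$, $T_{5,k}=\frac{T_{2,k}}{2(L_h+\bar\eta)}$. Say that real numbers $M_1,\dots,M_5,\hat B_f,\hat D_f$ are *bounds for the run with $K$ outer iterations* if $T_{i,k}\le M_i$ for $1\le i\le5$, $1\le k\le K-1$, and $\|\nabla f(\hat x_k)\|\le\hat B_f$, $|f(\hat x_k)|\le\hat D_f$ for $1\le k\le K$. Given such bounds put $c_{e,K}=16\alpha^{-1}a^2(\ln K)^2(M_1+M_2+M_3)$ and $c_{\delta,K}=\frac{M_4+M_5}{a}+2c_{e,K}+2\hat\gamma B_f\sqrt{c_{e,K}}$. Say that $K\ge 2$ is *large enough* if $16+16\frac{L_h}{\bar\eta}\le\Big(\frac{(\lfloor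 K/2\rfloor+1)^a}{a\ln(\lfloor K/2\rfloor+1)}\Big)^2$. **Theorem.** If $\mathcal B\subseteq\mathrm{dom}\,\omega$, there are numbers $M_1,\dots,M_5,\hat B_f,\hat D_f$, independent of $K$, that are bounds for the run with $K$ outer iterations for every admissible $K$. Moreover, for every box $\mathcal B$: (i) [infeasibility] For every admissible, large enough $K\ge2$ and all bounds for the run with $K$ outer iterations, $$\mathrm{dist}(\hat x_K,X^*)\le4\sqrt{\alpha^{-1}(M_1+M_2+M_3)}\;\frac{a\ln K}{K^a}.$$ Also, there is a constant $C$ independent of $K$ with $\mathrm{dist}(\hat x_K,X^*)\le C\,\frac{\ln K}{K^a}$ for all admissible $K\ge2$. (ii) [residual mapping] For every admissible, large enough $K\ge6$ and all bounds for the run with $K$ outer iterations, $$\|G_{1/\hat\gamma}(\hat x_K^*)\|^2\le\frac{8(\hat D_f-\hat C_f)}{\sqrt K}+\frac{2L_f\hat B_f^2}{\sqrt K}+\frac{320(c_{e,K}+c_{\delta,K})3^a}{L_f(a-1)}\cdot\frac1{K^{a-1.5}}.$$ Also, there is a constant $C$ independent of $K$ with $\|G_{1/\hat\gamma}(\hat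 x_K^*)\|^2\le C\big(\frac1{\sqrt K}+\frac{(\ln K)^2}{K^{a-1.5}}\big)$ for all admissible $K\ge2$. (iii) [total iteration complexity] There is a constant $C$ such that for every $\epsilon\in(0,1]$ there is $N\le C\epsilon^{-2}$ for which every $K\ge N$ is admissible with $\|G_{1/\hat\gamma}(\hat x_K^*)\|^2\le\epsilon$, and the total number of inner iterations of the run with $N$ outer iterations satisfies $\sum_{k=0}^{N-1}J_k\le C\epsilon^{-2a-2}$. -/

import Mathlib

noncomputable section

namespace Bilevel

/-- The space `ℝⁿ` with its Euclidean norm. -/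
abbrev E (n : ℕ) := EuclideanSpace ℝ (Fin n)

/-! ### Smooth functions, extended-valued convex functions, projections, proximal maps -/

/-- `f` is `L`-smooth: differentiable with `L`-Lipschitz gradient. -/
def IsSmooth {n : ℕ} (L : ℝ) (f : E n → ℝ) : Prop :=
  Differentiable ℝ f ∧ ∀ x y, ‖gradient f x - gradient f y‖ ≤ L * ‖x - y‖

/-- `g : ℝⁿ → (-∞, ∞]` is proper, closed and convex. -/
structure ProperClosedConvex {n : ℕ} (g : E n → EReal) : Prop where
  ne_bot : ∀ x, g x ≠ ⊥
  proper : ∃ x, g x ≠ ⊤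
  closed : LowerSemicontinuous g
  convex : Convex ℝ {p : E n × ℝ | g p.1 ≤ (p.2 : EReal)}

/-- `u` minimizes `v ↦ g v + ½ ‖v - x‖²`. -/
def IsProx {n : ℕ} (g : E n → EReal) (x u : E n) : Prop :=
  ∀ v, g u + ((1 / 2 * ‖u - x‖ ^ 2 : ℝ) : EReal) ≤ g v + ((1 / 2 * ‖v - x‖ ^ 2 : ℝ) : EReal)

/-- The proximal map: the minimizer of `v ↦ g v + ½ ‖v - x‖²`
(it exists and is unique when `g` is proper, closed and convex). -/
def prox {n : ℕ} (g : E n → EReal) (x : E n) : E n :=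
  Classical.epsilon (IsProx g x)

/-- `p` is a nearest point to `x` in `S`. -/
def IsProj {n : ℕ} (S : Set (E n)) (x p : E n) : Prop :=
  p ∈ S ∧ ∀ q ∈ S, ‖x - p‖ ≤ ‖x - q‖

/-- Euclidean projection: the nearest point to `x` in `S`
(it exists and is unique when `S` is nonempty, closed and convex). -/
def proj {n : ℕ} (S : Set (E n)) (x : E n) : E n :=
  Classical.epsilon (IsProj S x)

/-! ### The bilevel problem -/

/-- Data of the problem `min f(x)` subject to `x ∈ argmin (h + ω)`, together with the smoothness
constants `Lf`, `Lh` of `f`, `h` and the quadratic growth constant `α`. -/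
structure Problem (n : ℕ) where
  f : E n → ℝ
  h : E n → ℝ
  ω : E n → EReal
  Lf : ℝ
  Lh : ℝ
  α : ℝ

namespace Problem

variable {n : ℕ} (P : Problem n)

/-- The lower-level objective `h̄ = h + ω`. -/
def hbar (x : E n) : EReal := (P.h x : EReal) + P.ω x

/-- The lower-level optimal value `h̄*`. -/
def hstar : EReal := ⨅ x, P.hbar x

/-- The lower-level solution set `X* = argmin h̄`. -/
def sol : Set (E n) := {x | ∀ y, P.hbar x ≤ P.hbar y}

/-- The effective domain of `ω` (equivalently of `h̄`). -/
def dom : Set (E n) := {x | P.ω x ≠ ⊤}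

/-- The standing assumptions: `f` smooth and bounded below, `h` smooth and convex, `ω` proper closed
convex, `X*` nonempty and bounded, quadratic growth of `h̄` away from `X*`. -/
structure Assumptions : Prop where
  Lf_pos : 0 < P.Lf
  Lh_pos : 0 < P.Lh
  α_pos : 0 < P.α
  f_smooth : IsSmooth P.Lf P.f
  h_smooth : IsSmooth P.Lh P.h
  h_convex : ConvexOn ℝ Set.univ P.h
  ω_pcc : ProperClosedConvex P.ω
  sol_nonempty : P.sol.Nonempty
  quadratic_growth : ∀ x,
    P.hstar + ((P.α * Metric.infDist x P.sol ^ 2 : ℝ) : EReal) ≤ P.hbar x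
  f_bddBelow : BddBelow (Set.range P.f)
  sol_bounded : Bornology.IsBounded P.sol

/-- The residual mapping `G_{1/γ}(x) = (1/γ) (x - Π_{X*}[x - γ ∇f(x)])`. -/
def residual (γ : ℝ) (x : E n) : E n :=
  (1 / γ) • (x - proj P.sol (x - γ • gradient P.f x))

end Problem

/-! ### The algorithm -/

/-- Inputs of the algorithm other than the number `K` of outer iterations: initial vectors `x̂₀` and
`x₀₀ = y₀₀`, the box `[lo, hi]`, the scalar `η̄` and the exponent `a`. -/
structure Input (n : ℕ) where
  xhat0 : E n
  x00 : E n
  lo : E n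
  hi : E n
  ηbar : ℝ
  a : ℝ

namespace Input

variable {n : ℕ} (I : Input n)

/-- The bounded box `∏ᵢ [loᵢ, hiᵢ]`. -/
def box : Set (E n) := {x | ∀ i, I.lo i ≤ x i ∧ x i ≤ I.hi i}

/-- Admissible inputs: nonempty box, `η̄ > 0`, `a ≥ 2`. -/
structure Valid : Prop where
  box_le : ∀ i, I.lo i ≤ I.hi i
  ηbar_pos : 0 < I.ηbar
  two_le_a : 2 ≤ I.a

/-- The number `J_k = (k+1)^a` of inner iterations, rounded up if it is not an integer. -/
def J (k : ℕ) : ℕ := ⌈((k : ℝ) + 1) ^ I.a⌉₊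

end Input

variable {n : ℕ} (P : Problem n) (I : Input n)

/-- The outer stepsize `γ̂ = 1/√K`. -/
def gammaHat (K : ℕ) : ℝ := 1 / Real.sqrt K

/-- Admissible numbers of outer iterations: `K ≥ 1` and `γ̂ = 1/√K ≤ 1/(2 L_f)`. -/
def Admissible (K : ℕ) : Prop := 1 ≤ K ∧ gammaHat K ≤ 1 / (2 * P.Lf)

/-- `η_k = 16 (L_h + η̄) (ln J_k / J_k)²`. -/
def eta (k : ℕ) : ℝ :=
  16 * (P.Lh + I.ηbar) * (Real.log (I.J k) / (I.J k : ℝ)) ^ 2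

/-- `κ_k = (L_h + η_k) / η_k`. (For `k = 0` one has `J_0 = 1` and `η_0 = 0`; there `κ_0` only
enters `y_{0,1}`, which the algorithm never uses.) -/
def kappa (k : ℕ) : ℝ := (P.Lh + eta P I k) / eta P I k

/-- The inner stepsize `γ_k = 1 / (L_h + η_k)`. -/
def gammaIn (k : ℕ) : ℝ := 1 / (P.Lh + eta P I k)

/-- One inner iteration `(x_{k,j}, y_{k,j}) ↦ (x_{k,j+1}, y_{k,j+1})`. -/
def innerStep (k : ℕ) (z : E n) (s : E n × E n) : E n × E n :=
  let x' := prox (fun u => ((gammaIn P I k : ℝ) : EReal) * P.ω u)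
    (s.2 - gammaIn P I k • (gradient P.h s.2 + eta P I k • (s.2 - z)))
  (x', x' + ((Real.sqrt (kappa P I k) - 1) / (Real.sqrt (kappa P I k) + 1)) • (x' - s.1))

/-- The inner iterate `x_{k,j}` started at `x_{k,0} = y_{k,0} = x₀`. -/
def innerX (k : ℕ) (z x₀ : E n) (j : ℕ) : E n :=
  ((innerStep P I k z)^[j] (x₀, x₀)).1

/-- The outer recursion for a run with `K` outer iterations: the pair `(x̂_k, x_{k,0})`. -/
def outer (K : ℕ) : ℕ → E n × E n
  | 0 => (I.xhat0, I.x00)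
  | k + 1 =>
    let s := outer K k
    let out := innerX P I k (s.1 - gammaHat K • gradient P.f s.1) s.2 (I.J k)
    (out, proj I.box out)

/-- The outer iterate `x̂_k` of the run with `K` outer iterations. -/
def xhat (K k : ℕ) : E n := (outer P I K k).1

/-- The starting point `x_{k,0}` of the `k`-th inner loop. -/
def xinit (K k : ℕ) : E n := (outer P I K k).2

/-- `z_k = x̂_k - γ̂ ∇f(x̂_k)`. -/
def zpt (K k : ℕ) : E n :=
  xhat P I K k - gammaHat K • gradient P.f (xhat P I K k)

/-- `f_{s,k}(x) = ½ ‖x - z_k‖²`. -/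
def fs (K k : ℕ) (x : E n) : ℝ := 1 / 2 * ‖x - zpt P I K k‖ ^ 2

/-- `min_{⌊K/2⌋ ≤ k ≤ K-1} ‖G_{1/γ̂}(x̂_k)‖` (a minimum over a finite set, nonempty if `K ≥ 1`). -/
def bestResidual (K : ℕ) : ℝ :=
  sInf ((fun k => ‖P.residual (gammaHat K) (xhat P I K k)‖) '' Set.Ico (K / 2) K)

/-! ### The constants in the explicit bounds -/

def T1 (K k : ℕ) : ℝ :=
  (P.Lh + I.ηbar) *
    (fs P I K k (xinit P I K k) + 1 / 2 * Metric.infDist (xinit P I K k) P.sol ^ 2)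

/-- `h̄(x_{k,0}) - h̄*`, equal to `+∞` when `x_{k,0}` is outside the domain. -/
def T2 (K k : ℕ) : EReal := P.hbar (xinit P I K k) - P.hstar

def T3 (K k : ℕ) : ℝ :=
  (P.Lh + I.ηbar) * fs P I K k (proj P.sol (xinit P I K k))

def T4 (K k : ℕ) : ℝ :=
  2 * (fs P I K k (xinit P I K k) +
    1 / 2 * ‖xinit P I K k - proj P.sol (zpt P I K k)‖ ^ 2)

def T5 (K k : ℕ) : EReal := T2 P I K k / ((2 * (P.Lh + I.ηbar) : ℝ) : EReal)

/-- A tuple of candidate constants `M₁, …, M₅`, `B̂_f`, `D̂_f`. -/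
structure Consts where
  M1 : ℝ
  M2 : ℝ
  M3 : ℝ
  M4 : ℝ
  M5 : ℝ
  Bhat : ℝ
  Dhat : ℝ

/-- The constants bound the respective quantities along the run with `K` outer iterations. -/
structure Consts.Bounds (c : Consts) (K : ℕ) : Prop where
  T1_le : ∀ k, 1 ≤ k → k < K → T1 P I K k ≤ c.M1
  T2_le : ∀ k, 1 ≤ k → k < K → T2 P I K k ≤ (c.M2 : EReal)
  T3_le : ∀ k, 1 ≤ k → k < K → T3 P I K k ≤ c.M3
  T4_le : ∀ k, 1 ≤ k → k < K → T4 P I K k ≤ c.M4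
  T5_le : ∀ k, 1 ≤ k → k < K → T5 P I K k ≤ (c.M5 : EReal)
  grad_le : ∀ k, 1 ≤ k → k ≤ K → ‖gradient P.f (xhat P I K k)‖ ≤ c.Bhat
  f_le : ∀ k, 1 ≤ k → k ≤ K → |P.f (xhat P I K k)| ≤ c.Dhat

/-- `B_f = sup_{x ∈ box ∪ X*} ‖∇f(x)‖`. -/
def gradSup : ℝ := sSup ((fun x => ‖gradient P.f x‖) '' (I.box ∪ P.sol))

/-- `c_{e,K} = 16 α⁻¹ a² (ln K)² (M₁ + M₂ + M₃)`. -/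
def cE (c : Consts) (K : ℕ) : ℝ :=
  16 * P.α⁻¹ * I.a ^ 2 * Real.log K ^ 2 * (c.M1 + c.M2 + c.M3)

/-- `c_{δ,K} = (M₄ + M₅)/a + 2 c_{e,K} + 2 γ̂ B_f √c_{e,K}`. -/
def cDelta (c : Consts) (K : ℕ) : ℝ :=
  (c.M4 + c.M5) / I.a + 2 * cE P I c K + 2 * gammaHat K * gradSup P I * Real.sqrt (cE P I c K)

/-- `16 + 16 L_h/η̄ ≤ ((⌊K/2⌋+1)^a / (a ln(⌊K/2⌋+1)))²` (meaningful for `K ≥ 2`). -/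
def LargeEnough (K : ℕ) : Prop :=
  16 + 16 * (P.Lh / I.ηbar) ≤
    ((((K / 2 : ℕ) : ℝ) + 1) ^ I.a / (I.a * Real.log (((K / 2 : ℕ) : ℝ) + 1))) ^ 2

end Bilevel

end

/-!
The run is analysed on two levels.

*Inner loop.* For each outer index `k` the inner loop is an accelerated proximal gradient method for
`φ = h + ω + η_k f_{s,k}`, which is `η_k`-strongly convex with an `(L_h + η_k)`-smooth part. The
Lyapunov function `φ(x_j) - φ(x) + (η_k/2) ‖x - v_j‖²` contracts by the factor `1 - 1/√κ_k` in each
step, and it does so for *every* reference point `x ∈ dom ω`, not only for the minimizer of `φ`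
(`potential_innerStep_le`). The choice `η_k = 16 (L_h + η̄) (ln J_k / J_k)²` makes the accumulated
factor at most `J_k⁻⁴` as soon as `η_k ≤ η̄` (`one_sub_inv_sqrt_kappa_pow_le`). Two reference points
are used. With `x = Π_{X*}[x_{k,0}]`, the value `h̄(x̂_{k+1}) - h̄*` is `O((ln J_k / J_k)²)`, and
quadratic growth turns this into an infeasibility `O(ln J_k / J_k)` (`infDist_innerX_sq_le`). With
`x = Π_{X*}[z_k]`, dividing by `η_k` shows that `x̂_{k+1}` is almost as close to `z_k` as the exact
projection (`norm_innerX_sub_sq_le`). If the starting point lies outside `dom ω`, the first proximal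
step enters the domain with controlled Lyapunov value, at the cost of constants and of one factor
(`innerX_rates`).

*Outer loop.* Hence `x̂_{k+1}` is an inexact projected gradient step for `f` on `X*`.
The descent inequality for `f` and the variational inequality of the projection bound
`(3/8) γ̂² ‖G‖²` by `γ̂ (f(x̂_k) - f(x̂_{k+1}))` plus error terms (`residual_descent`). The sum over
`⌊K/2⌋ < k < K`, which has at least `K/3` terms when `K ≥ 6`, gives `bestResidual_sq_le`; the explicit
bound follows by Young's inequality (`explicit_error_le`).

*Uniform constants.* The statements with constants independent of `K` need all runs to stay in one
bounded set (`exists_norm_xhat_le`). For a fixed index this holds because the proximal map is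
nonexpansive; for large indices `x̂_{k+1}` returns to the bounded set `X*` up to a small multiple of
the size of `x̂_k`. Since `a ≥ 2`, the error terms at indices `k > K/2` are of lower order and the
squared residual is `O(1/√K)` (`exists_bestResidual_sq_le`); no logarithm survives, which is what the
complexity `O(ε⁻²)` requires when `a = 2`.
-/

namespace Bilevel

open Set Filter Topology

/-! ### Smooth and convex functions on Euclidean space -/

/-- Letting `t → 0` in `c ≤ t d`. -/
lemma nonpos_of_forall_le_mul {c d : ℝ} (h : ∀ t : ℝ, 0 < t → t < 1 → c ≤ t * d) : c ≤ 0 := by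
  by_contra! hc
  have hd : 0 < |d| + c := by positivity
  have h1 := h (c / (2 * (|d| + c))) (by positivity) (by
    rw [div_lt_one (by positivity)]
    nlinarith [abs_nonneg d])
  have h2 : c / (2 * (|d| + c)) * d ≤ c / (2 * (|d| + c)) * (|d| + c) := by
    gcongr
    linarith [le_abs_self d]
  have h3 : c / (2 * (|d| + c)) * (|d| + c) = c / 2 := by field_simp
  linarith

variable {n : ℕ}

lemma hasDerivAt_comp_line {f : E n → ℝ} (hf : Differentiable ℝ f) (x v : E n) (t : ℝ) :
    HasDerivAt (fun s : ℝ => f (x + s • v)) (inner ℝ (gradient f (x + t • v)) v) t := by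
  have h1 : HasDerivAt (fun s : ℝ => x + s • v) v t := by
    simpa using ((hasDerivAt_id t).smul_const v).const_add x
  have h2 := (hf (x + t • v)).hasFDerivAt.comp_hasDerivAt t h1
  rw [inner_gradient_left]
  exact h2

/-- The descent lemma for `L`-smooth functions. -/
lemma IsSmooth.le_quadratic {f : E n → ℝ} {L : ℝ} (hf : IsSmooth L f) (x y : E n) :
    f y ≤ f x + inner ℝ (gradient f x) (y - x) + L / 2 * ‖y - x‖ ^ 2 := by
  set v := y - x with hv
  let g : ℝ → ℝ := fun s =>
    f (x + s • v) - s * inner ℝ (gradient f x) v - L / 2 * s ^ 2 * ‖v‖ ^ 2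
  have hg : ∀ t, HasDerivAt g (inner ℝ (gradient f (x + t • v)) v
      - inner ℝ (gradient f x) v - L * t * ‖v‖ ^ 2) t := by
    intro t
    have h := ((hasDerivAt_comp_line hf.1 x v t).sub
      ((hasDerivAt_id t).mul_const (inner ℝ (gradient f x) v))).sub
      ((((hasDerivAt_id t).pow 2).const_mul (L / 2)).mul_const (‖v‖ ^ 2))
    refine h.congr_deriv ?_
    simp only [id_eq, Nat.cast_ofNat]
    ring
  have hanti : AntitoneOn g (Icc 0 1) := by
    apply antitoneOn_of_deriv_nonpos (convex_Icc 0 1)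
      (fun t _ => (hg t).continuousAt.continuousWithinAt)
      (fun t _ => (hg t).differentiableAt.differentiableWithinAt)
    intro t ht
    rw [interior_Icc] at ht
    rw [(hg t).deriv, ← inner_sub_left]
    have h1 := real_inner_le_norm (gradient f (x + t • v) - gradient f x) v
    have h2 := hf.2 (x + t • v) x
    rw [add_sub_cancel_left, norm_smul, Real.norm_of_nonneg ht.1.le] at h2
    nlinarith [mul_le_mul_of_nonneg_right h2 (norm_nonneg v)]
  have h := hanti (left_mem_Icc.2 zero_le_one) (right_mem_Icc.2 zero_le_one) zero_le_one
  simp only [g, one_smul, zero_smul, add_zero, hv, add_sub_cancel] at h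
  simp only [hv]
  linarith

/-- The gradient inequality for differentiable convex functions. -/
lemma gradient_inequality {f : E n → ℝ} (hf : Differentiable ℝ f) (hc : ConvexOn ℝ univ f)
    (x y : E n) : f x + inner ℝ (gradient f x) (y - x) ≤ f y := by
  have h1 : ConvexOn ℝ univ (fun s : ℝ => f (x + s • (y - x))) := by
    refine ⟨convex_univ, fun s _ t _ a b ha hb hab => ?_⟩
    have := hc.2 (mem_univ (x + s • (y - x))) (mem_univ (x + t • (y - x))) ha hb hab
    convert this using 2
    obtain rfl : b = 1 - a := by linarith
    simp only [smul_eq_mul]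
    module
  have h2 := h1.le_slope_of_hasDerivAt (mem_univ 0) (mem_univ 1) zero_lt_one
    (hasDerivAt_comp_line hf x (y - x) 0)
  simp [slope] at h2
  rw [inner_gradient_left, map_sub]
  linarith

lemma IsSmooth.continuous_gradient {f : E n → ℝ} {L : ℝ} (hf : IsSmooth L f) :
    Continuous (gradient f) := by
  have : LipschitzWith (Real.toNNReal L) (gradient f) := LipschitzWith.of_dist_le_mul fun x y => by
    rw [dist_eq_norm, dist_eq_norm]
    exact (hf.2 x y).trans (mul_le_mul_of_nonneg_right (Real.le_coe_toNNReal L) (norm_nonneg _))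
  exact this.continuous

lemma norm_combo_sq (u v : E n) (t : ℝ) :
    ‖(1 - t) • u + t • v‖ ^ 2
      = (1 - t) * ‖u‖ ^ 2 + t * ‖v‖ ^ 2 - t * (1 - t) * ‖u - v‖ ^ 2 := by
  rw [norm_sub_sq_real, norm_add_sq_real, norm_smul, norm_smul, inner_smul_left,
    inner_smul_right, mul_pow, mul_pow, Real.norm_eq_abs, Real.norm_eq_abs, sq_abs, sq_abs]
  simp
  ring

/-! ### Projections -/

lemma isProj_proj {S : Set (E n)} (hS : IsClosed S) (hne : S.Nonempty) (x : E n) :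
    IsProj S x (proj S x) := by
  apply Classical.epsilon_spec (p := IsProj S x)
  obtain ⟨y, hy, h⟩ := hS.exists_infDist_eq_dist hne x
  refine ⟨y, hy, fun q hq => ?_⟩
  rw [← dist_eq_norm, ← dist_eq_norm, ← h]
  exact Metric.infDist_le_dist_of_mem hq

lemma proj_mem {S : Set (E n)} (hS : IsClosed S) (hne : S.Nonempty) (x : E n) :
    proj S x ∈ S := (isProj_proj hS hne x).1

lemma norm_sub_proj {S : Set (E n)} (hS : IsClosed S) (hne : S.Nonempty) (x : E n) :
    ‖x - proj S x‖ = Metric.infDist x S := by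
  apply le_antisymm
  · obtain ⟨y, hy, h⟩ := hS.exists_infDist_eq_dist hne x
    rw [h, dist_eq_norm]
    exact (isProj_proj hS hne x).2 y hy
  · rw [← dist_eq_norm]
    exact Metric.infDist_le_dist_of_mem (proj_mem hS hne x)

/-- The variational inequality characterizing projections onto convex sets. -/
lemma inner_sub_proj_le {S : Set (E n)} (hS : IsClosed S) (hc : Convex ℝ S) (x : E n)
    {q : E n} (hq : q ∈ S) : inner ℝ (x - proj S x) (q - proj S x) ≤ 0 := by
  have hp := isProj_proj hS ⟨q, hq⟩ x
  refine (norm_eq_iInf_iff_real_inner_le_zero hc hp.1).1 ?_ q hq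
  have : Nonempty S := ⟨⟨q, hq⟩⟩
  exact le_antisymm (le_ciInf fun w => hp.2 w w.2)
    (ciInf_le ⟨0, by rintro _ ⟨w, rfl⟩; positivity⟩ (⟨_, hp.1⟩ : S))

/-! ### The lower-level problem in real-valued form -/

namespace Problem

variable (P : Problem n)

/-- The real-valued version of `ω`, meaningful on its effective domain. -/
noncomputable def w (x : E n) : ℝ := (P.ω x).toReal

/-- The real-valued version of `h̄ = h + ω`, meaningful on the effective domain of `ω`. -/
noncomputable def hb (x : E n) : ℝ := P.h x + P.w x

variable {P}

lemma coe_w {x : E n} (hω : ProperClosedConvex P.ω) (hx : x ∈ P.dom) :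
    P.ω x = (P.w x : EReal) :=
  (EReal.coe_toReal hx (hω.ne_bot x)).symm

lemma hbar_eq {x : E n} (hω : ProperClosedConvex P.ω) (hx : x ∈ P.dom) :
    P.hbar x = (P.hb x : EReal) := by
  rw [hbar, hb, coe_w hω hx, EReal.coe_add]

lemma hbar_eq_top {x : E n} (hx : x ∉ P.dom) : P.hbar x = ⊤ := by
  have : P.ω x = ⊤ := by simpa [dom] using hx
  rw [hbar, this, EReal.coe_add_top]

lemma dom_combo {x y : E n} (hω : ProperClosedConvex P.ω) (hx : x ∈ P.dom) (hy : y ∈ P.dom)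
    {a b : ℝ} (ha : 0 ≤ a) (hb : 0 ≤ b) (hab : a + b = 1) :
    a • x + b • y ∈ P.dom ∧ P.w (a • x + b • y) ≤ a * P.w x + b * P.w y := by
  have h := hω.convex (x := (x, P.w x)) (y := (y, P.w y)) (by simp [coe_w hω hx])
    (by simp [coe_w hω hy]) ha hb hab
  simp only [Prod.smul_mk, Prod.mk_add_mk, mem_ofPred_eq, smul_eq_mul] at h
  have hd : a • x + b • y ∈ P.dom := ne_of_lt (h.trans_lt (EReal.coe_lt_top _))
  exact ⟨hd, by rwa [coe_w hω hd, EReal.coe_le_coe_iff] at h⟩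

lemma convexOn_w (hω : ProperClosedConvex P.ω) : ConvexOn ℝ P.dom P.w :=
  ⟨fun _ hx _ hy _ _ ha hb hab => (dom_combo hω hx hy ha hb hab).1,
    fun _ hx _ hy _ _ ha hb hab => (dom_combo hω hx hy ha hb hab).2⟩

namespace Assumptions

lemma sol_subset_dom (hP : P.Assumptions) : P.sol ⊆ P.dom := by
  intro x hx
  by_contra hxd
  obtain ⟨y, hy⟩ := hP.ω_pcc.proper
  have h := hx y
  rw [hbar_eq_top hxd, hbar_eq hP.ω_pcc hy, top_le_iff] at h
  exact EReal.coe_ne_top _ h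

lemma hstar_eq (hP : P.Assumptions) {x : E n} (hx : x ∈ P.sol) :
    P.hstar = (P.hb x : EReal) := by
  rw [← hbar_eq hP.ω_pcc (hP.sol_subset_dom hx)]
  exact le_antisymm (iInf_le _ x) (le_iInf hx)

lemma hb_le (hP : P.Assumptions) {x y : E n} (hx : x ∈ P.sol) (hy : y ∈ P.dom) :
    P.hb x ≤ P.hb y := by
  have h := hx y
  rwa [hbar_eq hP.ω_pcc hy, hbar_eq hP.ω_pcc (hP.sol_subset_dom hx),
    EReal.coe_le_coe_iff] at h

lemma growth (hP : P.Assumptions) {x y : E n} (hx : x ∈ P.sol) (hy : y ∈ P.dom) :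
    P.α * Metric.infDist y P.sol ^ 2 ≤ P.hb y - P.hb x := by
  have h := hP.quadratic_growth y
  rw [hP.hstar_eq hx, hbar_eq hP.ω_pcc hy, ← EReal.coe_add, EReal.coe_le_coe_iff] at h
  linarith

/-- Writing `X*` through `ω` alone reduces its closedness to that of the epigraph of `ω`. -/
lemma sol_eq (hP : P.Assumptions) {x : E n} (hx : x ∈ P.sol) :
    P.sol = {y | P.ω y ≤ ((P.hb x - P.h y : ℝ) : EReal)} := by
  ext y
  constructor
  · intro hy
    have := hP.hb_le hy (hP.sol_subset_dom hx)
    rw [mem_ofPred_eq, coe_w hP.ω_pcc (hP.sol_subset_dom hy), EReal.coe_le_coe_iff]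
    simp only [hb] at *
    linarith
  · intro hy v
    have hyd : y ∈ P.dom := ne_of_lt (lt_of_le_of_lt hy (EReal.coe_lt_top _))
    rw [mem_ofPred_eq, coe_w hP.ω_pcc hyd, EReal.coe_le_coe_iff] at hy
    refine le_trans ?_ (hx v)
    rw [hbar_eq hP.ω_pcc hyd, hbar_eq hP.ω_pcc (hP.sol_subset_dom hx), EReal.coe_le_coe_iff]
    simp only [hb] at *
    linarith

lemma isClosed_sol (hP : P.Assumptions) : IsClosed P.sol := by
  obtain ⟨x, hx⟩ := hP.sol_nonempty
  rw [hP.sol_eq hx]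
  have h : Continuous fun y : E n => (y, ((P.hb x - P.h y : ℝ) : EReal)) := by
    have := hP.h_smooth.1.continuous
    exact continuous_id.prodMk (continuous_coe_real_ereal.comp (by fun_prop))
  exact hP.ω_pcc.closed.isClosed_epigraph.preimage h

lemma convex_sol (hP : P.Assumptions) : Convex ℝ P.sol := by
  intro x hx y hy a b ha hb hab v
  obtain ⟨hd, hw⟩ :=
    dom_combo hP.ω_pcc (hP.sol_subset_dom hx) (hP.sol_subset_dom hy) ha hb hab
  have hh := hP.h_convex.2 (mem_univ x) (mem_univ y) ha hb hab
  refine le_trans ?_ (hx v)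
  rw [hbar_eq hP.ω_pcc hd, hbar_eq hP.ω_pcc (hP.sol_subset_dom hx), EReal.coe_le_coe_iff]
  have hxy := hP.hb_le hy (hP.sol_subset_dom hx)
  obtain rfl : a = 1 - b := by linarith
  simp only [Problem.hb, smul_eq_mul] at *
  nlinarith

/-- First-order optimality: `-∇h(x)` is a subgradient of `ω` at any lower-level solution `x`. In
particular `ω` has an affine minorant. -/
lemma subgradient (hP : P.Assumptions) {x v : E n} (hx : x ∈ P.sol) (hv : v ∈ P.dom) :
    P.w x - inner ℝ (gradient P.h x) (v - x) ≤ P.w v := by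
  have key := nonpos_of_forall_le_mul (c := P.w x - inner ℝ (gradient P.h x) (v - x) - P.w v)
    (d := P.Lh / 2 * ‖v - x‖ ^ 2) (fun t ht ht1 => by
      obtain ⟨hd, hw⟩ := dom_combo hP.ω_pcc (hP.sol_subset_dom hx) hv
        (sub_nonneg.2 ht1.le) ht.le (sub_add_cancel 1 t)
      have h1 := hP.hb_le hx hd
      have h2 := hP.h_smooth.le_quadratic x ((1 - t) • x + t • v)
      have h3 : (1 - t) • x + t • v - x = t • (v - x) := by module
      rw [h3, inner_smul_right, norm_smul, Real.norm_of_nonneg ht.le] at h2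
      simp only [hb] at h1
      have h4 : t * (P.w x - inner ℝ (gradient P.h x) (v - x) - P.w v)
          ≤ t * (t * (P.Lh / 2 * ‖v - x‖ ^ 2)) := by nlinarith
      exact le_of_mul_le_mul_left h4 ht)
  linarith

end Assumptions

/-! ### The proximal map -/

namespace Assumptions

/-- Existence of proximal points: the objective is lower semicontinuous, and the affine minorant of
`ω` confines its minimization to a compact ball. -/
lemma exists_isProx (hP : P.Assumptions) {γ : ℝ} (hγ : 0 < γ) (x : E n) :
    ∃ u, IsProx (fun v => (γ : EReal) * P.ω v) x u := by
  obtain ⟨x₀, hx₀⟩ := hP.sol_nonempty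
  have hd₀ := hP.sol_subset_dom hx₀
  set c : ℝ := 1 / (2 * γ) with hc
  have hc0 : 0 < c := by positivity
  set G := ‖gradient P.h x₀‖
  set D := ‖x₀ - x‖
  have hG : 0 ≤ G := norm_nonneg _
  have hD : 0 ≤ D := norm_nonneg _
  -- outside the ball of radius `R` the quadratic term dominates the affine minorant
  let R : ℝ := D + 2 * G / c
  have hR : 0 ≤ 2 * G / c := by positivity
  have hlsc : LowerSemicontinuous fun v => P.ω v + ((c * ‖v - x‖ ^ 2 : ℝ) : EReal) := by
    refine hP.ω_pcc.closed.add' (Continuous.lowerSemicontinuous ?_) fun v => ?_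
    · exact continuous_coe_real_ereal.comp (by fun_prop)
    · exact EReal.continuousAt_add (Or.inr (EReal.coe_ne_bot _)) (Or.inr (EReal.coe_ne_top _))
  have hx₀R : x₀ ∈ Metric.closedBall x R := by
    rw [Metric.mem_closedBall, dist_eq_norm]
    linarith
  obtain ⟨u, hu, hmin⟩ := (hlsc.lowerSemicontinuousOn (Metric.closedBall x R)).exists_isMinOn
    ⟨x₀, hx₀R⟩ (isCompact_closedBall x R)
  have hud : u ∈ P.dom := by
    intro htop
    have h := hmin hx₀R
    simp only [mem_ofPred_eq] at h
    rw [htop, EReal.top_add_coe, coe_w hP.ω_pcc hd₀, ← EReal.coe_add, top_le_iff] at h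
    exact EReal.coe_ne_top _ h
  have hball : ∀ v ∈ P.dom, v ∈ Metric.closedBall x R →
      P.w u + c * ‖u - x‖ ^ 2 ≤ P.w v + c * ‖v - x‖ ^ 2 := by
    intro v hv hvR
    have h := hmin hvR
    simp only [mem_ofPred_eq] at h
    rwa [coe_w hP.ω_pcc hv, coe_w hP.ω_pcc hud, ← EReal.coe_add, ← EReal.coe_add,
      EReal.coe_le_coe_iff] at h
  have hall : ∀ v ∈ P.dom, P.w u + c * ‖u - x‖ ^ 2 ≤ P.w v + c * ‖v - x‖ ^ 2 := by
    intro v hv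
    by_cases hvR : v ∈ Metric.closedBall x R
    · exact hball v hv hvR
    refine (hball x₀ hd₀ hx₀R).trans ?_
    rw [Metric.mem_closedBall, dist_eq_norm, not_le] at hvR
    have h1 := hP.subgradient hx₀ hv
    have h2 := real_inner_le_norm (gradient P.h x₀) (v - x₀)
    have h3 : ‖v - x₀‖ ≤ ‖v - x‖ + D := by
      have := norm_sub_le (v - x) (x₀ - x)
      rwa [sub_sub_sub_cancel_right] at this
    have h4 := mul_le_mul_of_nonneg_left h3 hG
    have h5 : c * (D + 2 * G / c) = c * D + 2 * G := by field_simp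
    have h6 : c * D + 2 * G ≤ c * ‖v - x‖ := by
      rw [← h5]
      exact mul_le_mul_of_nonneg_left hvR.le hc0.le
    have h7 : D ≤ ‖v - x‖ := by linarith
    have h8 := mul_le_mul_of_nonneg_right h6 (norm_nonneg (v - x))
    have h9 : c * D * D ≤ c * D * ‖v - x‖ := mul_le_mul_of_nonneg_left h7 (by positivity)
    have h10 := mul_le_mul_of_nonneg_left h7 hG
    change P.w x₀ + c * D ^ 2 ≤ _
    nlinarith
  refine ⟨u, fun v => ?_⟩
  beta_reduce
  by_cases hv : v ∈ P.dom
  · have h := mul_le_mul_of_nonneg_left (hall v hv) hγ.le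
    have h1 : γ * c = 1 / 2 := by rw [hc]; field_simp
    rw [coe_w hP.ω_pcc hv, coe_w hP.ω_pcc hud, ← EReal.coe_mul, ← EReal.coe_mul,
      ← EReal.coe_add, ← EReal.coe_add, EReal.coe_le_coe_iff]
    rw [mul_add, mul_add, ← mul_assoc, ← mul_assoc, h1] at h
    exact h
  · have hv' : P.ω v = ⊤ := by simpa [dom] using hv
    rw [hv', EReal.coe_mul_top_of_pos hγ, EReal.top_add_coe]
    exact le_top

lemma prox_mem_dom (hP : P.Assumptions) {γ : ℝ} (hγ : 0 < γ) (x : E n) :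
    prox (fun v => (γ : EReal) * P.ω v) x ∈ P.dom := by
  have h := Classical.epsilon_spec (hP.exists_isProx hγ x)
  intro htop
  obtain ⟨y, hy⟩ := hP.ω_pcc.proper
  have h1 := h y
  beta_reduce at h1
  change P.ω (Classical.epsilon (IsProx (fun v => (γ : EReal) * P.ω v) x)) = ⊤ at htop
  rw [htop, EReal.coe_mul_top_of_pos hγ, EReal.top_add_coe, coe_w hP.ω_pcc hy, ← EReal.coe_mul,
    ← EReal.coe_add, top_le_iff] at h1
  exact EReal.coe_ne_top _ h1

/-- The three-point inequality: the proximal objective is `1`-strongly convex. -/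
lemma prox_inequality (hP : P.Assumptions) {γ : ℝ} (hγ : 0 < γ) (x : E n) {u v : E n}
    (hu : u = prox (fun v => (γ : EReal) * P.ω v) x) (hv : v ∈ P.dom) :
    γ * P.w u + 1 / 2 * ‖u - x‖ ^ 2 + 1 / 2 * ‖v - u‖ ^ 2
      ≤ γ * P.w v + 1 / 2 * ‖v - x‖ ^ 2 := by
  have hspec : IsProx (fun v => (γ : EReal) * P.ω v) x u :=
    hu ▸ Classical.epsilon_spec (hP.exists_isProx hγ x)
  have hud : u ∈ P.dom := hu ▸ hP.prox_mem_dom hγ x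
  have key := nonpos_of_forall_le_mul
    (c := γ * P.w u + 1 / 2 * ‖u - x‖ ^ 2 + 1 / 2 * ‖v - u‖ ^ 2
      - (γ * P.w v + 1 / 2 * ‖v - x‖ ^ 2))
    (d := 1 / 2 * ‖v - u‖ ^ 2) (fun t ht ht1 => by
      obtain ⟨hd, hw⟩ := dom_combo hP.ω_pcc hud hv
        (sub_nonneg.2 ht1.le) ht.le (sub_add_cancel 1 t)
      have h1 := hspec ((1 - t) • u + t • v)
      beta_reduce at h1
      rw [coe_w hP.ω_pcc hud, coe_w hP.ω_pcc hd, ← EReal.coe_mul, ← EReal.coe_mul,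
        ← EReal.coe_add, ← EReal.coe_add, EReal.coe_le_coe_iff] at h1
      have h3 : (1 - t) • u + t • v - x = (1 - t) • (u - x) + t • (v - x) := by module
      rw [h3, norm_combo_sq, sub_sub_sub_cancel_right, norm_sub_rev u v] at h1
      have h5 := mul_le_mul_of_nonneg_left hw hγ.le
      refine le_of_mul_le_mul_left ?_ ht
      nlinarith)
  linarith

lemma norm_prox_sub_prox_le (hP : P.Assumptions) {γ : ℝ} (hγ : 0 < γ) (x y : E n) :
    ‖prox (fun v => (γ : EReal) * P.ω v) x - prox (fun v => (γ : EReal) * P.ω v) y‖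
      ≤ ‖x - y‖ := by
  set u := prox (fun v => (γ : EReal) * P.ω v) x with hu
  set v := prox (fun v => (γ : EReal) * P.ω v) y with hv
  have h1 := hP.prox_inequality hγ x hu (hv ▸ hP.prox_mem_dom hγ y)
  have h2 := hP.prox_inequality hγ y hv (hu ▸ hP.prox_mem_dom hγ x)
  rw [norm_sub_rev v u] at h1
  have h3 : ‖v - x‖ ^ 2 + ‖u - y‖ ^ 2 - ‖u - x‖ ^ 2 - ‖v - y‖ ^ 2
      = 2 * inner ℝ (u - v) (x - y) := by
    simp only [norm_sub_sq_real, inner_sub_left, inner_sub_right]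
    ring
  have h4 := real_inner_le_norm (u - v) (x - y)
  by_contra! hlt
  nlinarith [norm_nonneg (x - y)]

end Assumptions
end Problem

variable {P : Problem n} {I : Input n}

/-! ### The accelerated inner loop -/

/-- The regularized lower-level objective `φ = h + ω + (η/2) ‖· - z‖²`, real-valued on `dom ω`. -/
noncomputable def Problem.innerObj (P : Problem n) (η : ℝ) (z x : E n) : ℝ :=
  P.hb x + η * (1 / 2 * ‖x - z‖ ^ 2)

/-- `φ` is `η`-strongly convex. -/
lemma innerObj_combo_le (hP : P.Assumptions) {η : ℝ} (z : E n) {x y : E n}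
    (hx : x ∈ P.dom) (hy : y ∈ P.dom) {t : ℝ} (h0 : 0 ≤ t) (h1 : t ≤ 1) :
    (1 - t) • x + t • y ∈ P.dom ∧
      P.innerObj η z ((1 - t) • x + t • y) ≤ (1 - t) * P.innerObj η z x + t * P.innerObj η z y
        - η / 2 * (t * (1 - t) * ‖x - y‖ ^ 2) := by
  obtain ⟨hd, hw⟩ := Problem.dom_combo hP.ω_pcc hx hy (sub_nonneg.2 h1) h0 (sub_add_cancel 1 t)
  have hh := hP.h_convex.2 (mem_univ x) (mem_univ y) (sub_nonneg.2 h1) h0 (sub_add_cancel 1 t)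
  have h3 : (1 - t) • x + t • y - z = (1 - t) • (x - z) + t • (y - z) := by module
  refine ⟨hd, ?_⟩
  simp only [Problem.innerObj, Problem.hb, smul_eq_mul] at *
  rw [h3, norm_combo_sq, sub_sub_sub_cancel_right]
  linarith

lemma eta_nonneg (hP : P.Assumptions) (hI : I.Valid) (k : ℕ) : 0 ≤ eta P I k := by
  have h1 := hP.Lh_pos
  have h2 := hI.ηbar_pos
  unfold eta
  positivity

lemma Lh_add_eta_pos (hP : P.Assumptions) (hI : I.Valid) (k : ℕ) : 0 < P.Lh + eta P I k :=
  add_pos_of_pos_of_nonneg hP.Lh_pos (eta_nonneg hP hI k)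

lemma gammaIn_pos (hP : P.Assumptions) (hI : I.Valid) (k : ℕ) : 0 < gammaIn P I k :=
  one_div_pos.2 (Lh_add_eta_pos hP hI k)

lemma innerStep_mem_dom (hP : P.Assumptions) (hI : I.Valid) (k : ℕ) (z : E n) (s : E n × E n) :
    (innerStep P I k z s).1 ∈ P.dom :=
  hP.prox_mem_dom (gammaIn_pos hP hI k) _

/-- The fundamental inequality of a proximal gradient step from `y = s.2` with step size
`1 / (L_h + η)`, where `φ` is `η`-strongly convex. -/
lemma innerStep_inequality (hP : P.Assumptions) (hI : I.Valid) (k : ℕ) (z : E n)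
    (s : E n × E n) {v : E n} (hv : v ∈ P.dom) :
    P.innerObj (eta P I k) z (innerStep P I k z s).1
        + (P.Lh + eta P I k) / 2 * ‖v - (innerStep P I k z s).1‖ ^ 2
      ≤ P.innerObj (eta P I k) z v + P.Lh / 2 * ‖v - s.2‖ ^ 2 := by
  have hL := Lh_add_eta_pos hP hI k
  have h1 := hP.prox_inequality (gammaIn_pos hP hI k)
    (s.2 - gammaIn P I k • (gradient P.h s.2 + eta P I k • (s.2 - z)))
    (u := (innerStep P I k z s).1) rfl hv
  set u := (innerStep P I k z s).1
  set η := eta P I k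
  set y := s.2
  have h2 := hP.h_smooth.le_quadratic y u
  have h3 := gradient_inequality hP.h_smooth.1 hP.h_convex y v
  set g := gradient P.h y
  rw [show gammaIn P I k = 1 / (P.Lh + η) from rfl] at h1
  set L := P.Lh + η with hLdef
  -- completing the square around `y`
  have hsq : ∀ p : E n, ‖p - (y - (1 / L) • (g + η • (y - z)))‖ ^ 2
      = ‖p - y‖ ^ 2 + 2 / L * (inner ℝ g (p - y) + η * inner ℝ (y - z) (p - y))
        + ‖(1 / L) • (g + η • (y - z))‖ ^ 2 := by
    intro p
    have : p - (y - (1 / L) • (g + η • (y - z))) = (p - y) + (1 / L) • (g + η • (y - z)) := by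
      abel
    rw [this, norm_add_sq_real, inner_smul_right, inner_add_right, inner_smul_right,
      real_inner_comm g, real_inner_comm (y - z)]
    ring
  have hz : ∀ p : E n, ‖p - z‖ ^ 2
      = ‖p - y‖ ^ 2 + 2 * inner ℝ (y - z) (p - y) + ‖y - z‖ ^ 2 := by
    intro p
    rw [← sub_add_sub_cancel p y z, norm_add_sq_real, real_inner_comm (y - z)]
  rw [hsq u, hsq v] at h1
  have h4 := mul_le_mul_of_nonneg_left h1 hL.le
  have e1 : L * (1 / L * P.w u + 1 / 2 * (‖u - y‖ ^ 2
        + 2 / L * (inner ℝ g (u - y) + η * inner ℝ (y - z) (u - y))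
        + ‖(1 / L) • (g + η • (y - z))‖ ^ 2) + 1 / 2 * ‖v - u‖ ^ 2)
      = P.w u + L / 2 * ‖u - y‖ ^ 2 + inner ℝ g (u - y) + η * inner ℝ (y - z) (u - y)
        + L / 2 * ‖(1 / L) • (g + η • (y - z))‖ ^ 2 + L / 2 * ‖v - u‖ ^ 2 := by
    field_simp
    ring
  have e2 : L * (1 / L * P.w v + 1 / 2 * (‖v - y‖ ^ 2
        + 2 / L * (inner ℝ g (v - y) + η * inner ℝ (y - z) (v - y))
        + ‖(1 / L) • (g + η • (y - z))‖ ^ 2))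
      = P.w v + L / 2 * ‖v - y‖ ^ 2 + inner ℝ g (v - y) + η * inner ℝ (y - z) (v - y)
        + L / 2 * ‖(1 / L) • (g + η • (y - z))‖ ^ 2 := by
    field_simp
    ring
  rw [e1, e2] at h4
  simp only [Problem.innerObj, Problem.hb]
  rw [hz u, hz v]
  simp only [hLdef] at h4 ⊢
  linarith

/-- The auxiliary point `v = x + (√κ + 1) (y - x)` of an inner state `(x, y)`; for the iterates it
equals `x_{j-1} + √κ (x_j - x_{j-1})`. -/
noncomputable def auxPoint (P : Problem n) (I : Input n) (k : ℕ) (s : E n × E n) : E n :=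
  s.1 + (Real.sqrt (kappa P I k) + 1) • (s.2 - s.1)

/-- The Lyapunov function `φ(x_j) - φ(x) + (η/2) ‖x - v_j‖²` of the inner loop, relative to an
arbitrary reference point `x`. -/
noncomputable def potential (P : Problem n) (I : Input n) (k : ℕ) (z x : E n) (s : E n × E n) : ℝ :=
  P.innerObj (eta P I k) z s.1 - P.innerObj (eta P I k) z x
    + eta P I k / 2 * ‖x - auxPoint P I k s‖ ^ 2

lemma one_lt_sqrt_kappa (hP : P.Assumptions) {k : ℕ} (hη : 0 < eta P I k) :
    1 < Real.sqrt (kappa P I k) := by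
  rw [Real.lt_sqrt zero_le_one, kappa, one_pow, lt_div_iff₀ hη]
  linarith [hP.Lh_pos]

lemma one_sub_inv_sqrt_kappa_nonneg (hP : P.Assumptions) {k : ℕ} (hη : 0 < eta P I k) :
    0 ≤ 1 - 1 / Real.sqrt (kappa P I k) := by
  have ht := one_lt_sqrt_kappa hP hη
  rw [sub_nonneg, div_le_one (by linarith)]
  exact ht.le

lemma eta_mul_sqrt_kappa_sq (hP : P.Assumptions) {k : ℕ} (hη : 0 < eta P I k) :
    eta P I k * Real.sqrt (kappa P I k) ^ 2 = P.Lh + eta P I k := by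
  have := hP.Lh_pos
  rw [Real.sq_sqrt (by unfold kappa; positivity), kappa, mul_div_cancel₀ _ hη.ne']

lemma auxPoint_innerStep (hP : P.Assumptions) {k : ℕ} (hη : 0 < eta P I k) (z : E n)
    (s : E n × E n) :
    auxPoint P I k (innerStep P I k z s) = (innerStep P I k z s).1
      + (Real.sqrt (kappa P I k) - 1) • ((innerStep P I k z s).1 - s.1) := by
  have ht := one_lt_sqrt_kappa hP hη
  have h2 : (innerStep P I k z s).2 - (innerStep P I k z s).1
      = ((Real.sqrt (kappa P I k) - 1) / (Real.sqrt (kappa P I k) + 1)) •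
        ((innerStep P I k z s).1 - s.1) := by
    simp only [innerStep]
    abel
  rw [auxPoint, h2, smul_smul, mul_div_cancel₀]
  linarith

/-- One accelerated step contracts the Lyapunov function, for every reference point of the domain:
apply the proximal gradient inequality at the convex combination of the reference point and the
current iterate with weight `1/√κ`. -/
lemma potential_innerStep_le (hP : P.Assumptions) (hI : I.Valid) {k : ℕ} (hη : 0 < eta P I k)
    (z : E n) {x : E n} (hx : x ∈ P.dom) {s : E n × E n} (hs : s.1 ∈ P.dom) :
    potential P I k z x (innerStep P I k z s)
      ≤ (1 - 1 / Real.sqrt (kappa P I k)) * potential P I k z x s := by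
  have ht := one_lt_sqrt_kappa hP hη
  have htk := eta_mul_sqrt_kappa_sq hP hη
  have haux := auxPoint_innerStep hP hη z s
  set t := Real.sqrt (kappa P I k)
  have ht0 : 0 < t := by linarith
  have hq1 : 1 / t ≤ 1 := by rw [div_le_one ht0]; exact ht.le
  obtain ⟨hd, hcombo⟩ := innerObj_combo_le hP (η := eta P I k) z hs hx
    (t := 1 / t) (by positivity) hq1
  have hstep := innerStep_inequality hP hI k z s hd
  have hauxs : auxPoint P I k s = s.1 + (t + 1) • (s.2 - s.1) := rfl
  simp only [potential]
  rw [haux]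
  rw [hauxs]
  set u := (innerStep P I k z s).1
  set η := eta P I k
  -- the distances to the convex combination, in terms of the new and the old auxiliary points
  have e1 : (1 - 1 / t) • s.1 + (1 / t) • x - u
      = (1 / t) • (x - (u + (t - 1) • (u - s.1))) := by
    match_scalars <;> field_simp; ring
  have e2 : (1 - 1 / t) • s.1 + (1 / t) • x - s.2
      = (1 / t) • ((1 - 1 / (t + 1)) • (x - (s.1 + (t + 1) • (s.2 - s.1)))
        + (1 / (t + 1)) • (x - s.1)) := by
    match_scalars <;> field_simp <;> ring
  rw [e1, e2, norm_smul, norm_smul, mul_pow, mul_pow, norm_combo_sq,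
    Real.norm_of_nonneg (by positivity : (0:ℝ) ≤ 1 / t)] at hstep
  set b := ‖x - (s.1 + (t + 1) • (s.2 - s.1))‖ ^ 2
  set V := ‖x - (u + (t - 1) • (u - s.1))‖ ^ 2
  rw [norm_sub_rev s.1 x] at hcombo
  set A := ‖x - s.1‖ ^ 2
  set r := ‖x - (s.1 + (t + 1) • (s.2 - s.1)) - (x - s.1)‖ ^ 2
  have f1 : (P.Lh + η) / 2 * ((1 / t) ^ 2 * V) = η / 2 * V := by
    rw [← htk]; field_simp
  have f2 : P.Lh / 2 * ((1 / t) ^ 2 * ((1 - 1 / (t + 1)) * b + 1 / (t + 1) * A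
      - 1 / (t + 1) * (1 - 1 / (t + 1)) * r))
      = η / 2 * (1 - 1 / t) * (b + 1 / t * A - 1 / (t + 1) * r) := by
    have : P.Lh = η * (t ^ 2 - 1) := by linarith
    rw [this]; field_simp; ring
  -- the remaining term has a favourable sign by convexity of the squared norm
  have f3 : 0 ≤ η / 2 * (1 - 1 / t) * (1 / (t + 1) * r) := by
    have : 0 ≤ 1 - 1 / t := by linarith
    positivity
  rw [f1, f2] at hstep
  nlinarith

lemma innerX_succ (k : ℕ) (z x₀ : E n) (j : ℕ) :
    innerX P I k z x₀ (j + 1)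
      = (innerStep P I k z ((innerStep P I k z)^[j] (x₀, x₀))).1 := by
  rw [innerX, Function.iterate_succ_apply']

lemma innerX_mem_dom (hP : P.Assumptions) (hI : I.Valid) (k : ℕ) (z x₀ : E n) {j : ℕ}
    (hj : 1 ≤ j) : innerX P I k z x₀ j ∈ P.dom := by
  obtain ⟨j, rfl⟩ := Nat.exists_eq_add_of_le' hj
  rw [innerX_succ]
  exact innerStep_mem_dom hP hI k z _

lemma potential_iterate_le (hP : P.Assumptions) (hI : I.Valid) {k : ℕ} (hη : 0 < eta P I k)
    (z : E n) {x : E n} (hx : x ∈ P.dom) {s : E n × E n} (hs : s.1 ∈ P.dom) (j : ℕ) :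
    potential P I k z x ((innerStep P I k z)^[j] s)
      ≤ (1 - 1 / Real.sqrt (kappa P I k)) ^ j * potential P I k z x s := by
  have hq := one_sub_inv_sqrt_kappa_nonneg hP hη
  have hd : ∀ j, ((innerStep P I k z)^[j] s).1 ∈ P.dom := by
    intro j
    cases j with
    | zero => exact hs
    | succ j =>
      rw [Function.iterate_succ_apply']
      exact innerStep_mem_dom hP hI k z _
  induction j with
  | zero => simp
  | succ j ih =>
    rw [Function.iterate_succ_apply', pow_succ', mul_assoc]
    exact (potential_innerStep_le hP hI hη z hx (hd j)).trans
      (mul_le_mul_of_nonneg_left ih hq)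

/-- Linear convergence of the inner loop from a starting point in the domain. -/
lemma innerObj_innerX_le (hP : P.Assumptions) (hI : I.Valid) {k : ℕ} (hη : 0 < eta P I k)
    (z : E n) {x x₀ : E n} (hx : x ∈ P.dom) (hx₀ : x₀ ∈ P.dom) (j : ℕ) :
    P.innerObj (eta P I k) z (innerX P I k z x₀ j) - P.innerObj (eta P I k) z x
      ≤ (1 - 1 / Real.sqrt (kappa P I k)) ^ j *
        (P.innerObj (eta P I k) z x₀ - P.innerObj (eta P I k) z x
          + eta P I k / 2 * ‖x - x₀‖ ^ 2) := by
  have h := potential_iterate_le hP hI hη z hx (s := (x₀, x₀)) hx₀ j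
  simp only [potential, auxPoint, sub_self, smul_zero, add_zero] at h
  refine le_trans ?_ h
  rw [← auxPoint, innerX]
  exact le_add_of_nonneg_right (by positivity)

/-- Linear convergence of the inner loop from an arbitrary starting point, relative to a lower-level
solution: the first step already lands in the domain, with controlled potential. -/
lemma innerObj_innerX_le_of_mem_sol (hP : P.Assumptions) (hI : I.Valid) {k : ℕ}
    (hη : 0 < eta P I k) (z : E n) {x : E n} (hx : x ∈ P.sol) (x₀ : E n) (j : ℕ) :
    P.innerObj (eta P I k) z (innerX P I k z x₀ (j + 1)) - P.innerObj (eta P I k) z x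
      ≤ (1 - 1 / Real.sqrt (kappa P I k)) ^ j *
        (2 * (P.Lh + eta P I k) * ‖x - x₀‖ ^ 2 + eta P I k * (1 / 2 * ‖x - z‖ ^ 2)) := by
  have hxd := hP.sol_subset_dom hx
  have ht := one_lt_sqrt_kappa hP hη
  have htk := eta_mul_sqrt_kappa_sq hP hη
  have h := potential_iterate_le hP hI hη z hxd (s := innerStep P I k z (x₀, x₀))
    (innerStep_mem_dom hP hI k z _) j
  have h1 := innerStep_inequality hP hI k z (x₀, x₀) hxd
  have haux := auxPoint_innerStep hP hη z (x₀, x₀)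
  have h2 := hP.hb_le hx (innerStep_mem_dom hP hI k z (x₀, x₀))
  have hL := hP.Lh_pos
  rw [← Function.iterate_succ_apply (innerStep P I k z) j (x₀, x₀)] at h
  have hq : 0 ≤ (1 - 1 / Real.sqrt (kappa P I k)) ^ j :=
    pow_nonneg (one_sub_inv_sqrt_kappa_nonneg hP hη) j
  have h3 : P.innerObj (eta P I k) z (innerX P I k z x₀ (j + 1)) - P.innerObj (eta P I k) z x
      ≤ potential P I k z x ((innerStep P I k z)^[j + 1] (x₀, x₀)) :=
    le_add_of_nonneg_right (by positivity)
  refine h3.trans (h.trans (mul_le_mul_of_nonneg_left ?_ hq))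
  simp only [potential]
  rw [haux]
  set t := Real.sqrt (kappa P I k)
  set u := (innerStep P I k z (x₀, x₀)).1
  set η := eta P I k
  have e : x - (u + (t - 1) • (u - x₀)) = t • (x - u) - (t - 1) • (x - x₀) := by module
  have h4 : ‖x - (u + (t - 1) • (u - x₀))‖ ^ 2
      ≤ 2 * t ^ 2 * ‖x - u‖ ^ 2 + 2 * t ^ 2 * ‖x - x₀‖ ^ 2 := by
    have h5 := norm_sub_le (t • (x - u)) ((t - 1) • (x - x₀))
    rw [← e, norm_smul, norm_smul, Real.norm_of_nonneg (by linarith : 0 ≤ t),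
      Real.norm_of_nonneg (by linarith : 0 ≤ t - 1)] at h5
    have h6 : (t - 1) * ‖x - x₀‖ ≤ t * ‖x - x₀‖ := by
      gcongr; linarith
    have h7 : ‖x - (u + (t - 1) • (u - x₀))‖ ^ 2 ≤ (t * ‖x - u‖ + t * ‖x - x₀‖) ^ 2 := by
      gcongr; linarith
    nlinarith [sq_nonneg (t * ‖x - u‖ - t * ‖x - x₀‖)]
  have h8 := mul_le_mul_of_nonneg_left h4 (by positivity : 0 ≤ η / 2)
  have h9 : η / 2 * (2 * t ^ 2 * ‖x - u‖ ^ 2 + 2 * t ^ 2 * ‖x - x₀‖ ^ 2)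
      = (P.Lh + η) * ‖x - u‖ ^ 2 + (P.Lh + η) * ‖x - x₀‖ ^ 2 := by
    rw [← htk]; ring
  have h10 : 0 ≤ η * (1 / 2 * ‖u - z‖ ^ 2) := by positivity
  have h11 : 0 ≤ η * ‖x - x₀‖ ^ 2 := by positivity
  simp only [Problem.innerObj] at *
  linarith

/-! ### The number of inner iterations and the contraction factor -/

lemma rpow_le_J (I : Input n) (k : ℕ) : ((k : ℝ) + 1) ^ I.a ≤ I.J k := Nat.le_ceil _

lemma four_le_rpow (hI : I.Valid) {k : ℕ} (hk : 1 ≤ k) : (4 : ℝ) ≤ ((k : ℝ) + 1) ^ I.a := by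
  have hk' : (1 : ℝ) ≤ k := by exact_mod_cast hk
  calc (4 : ℝ) = 2 ^ (2 : ℝ) := by norm_num
    _ ≤ 2 ^ I.a := Real.rpow_le_rpow_of_exponent_le one_le_two hI.two_le_a
    _ ≤ _ := Real.rpow_le_rpow zero_le_two (by linarith) (by linarith [hI.two_le_a])

lemma four_le_J (hI : I.Valid) {k : ℕ} (hk : 1 ≤ k) : (4 : ℝ) ≤ I.J k :=
  (four_le_rpow hI hk).trans (rpow_le_J I k)

lemma one_le_log_of_four_le {x : ℝ} (hx : 4 ≤ x) : 1 ≤ Real.log x := by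
  rw [Real.le_log_iff_exp_le (by linarith)]
  linarith [Real.exp_one_lt_d9]

lemma exp_one_le_four : Real.exp 1 ≤ 4 := by linarith [Real.exp_one_lt_d9]

lemma log_J_div_J_le (hI : I.Valid) {k : ℕ} (hk : 1 ≤ k) :
    Real.log (I.J k) / I.J k ≤ I.a * Real.log ((k : ℝ) + 1) / ((k : ℝ) + 1) ^ I.a := by
  have h4 := four_le_rpow hI hk
  rw [← Real.log_rpow (by positivity)]
  exact Real.log_div_self_antitoneOn (mem_Ici.2 (exp_one_le_four.trans h4))
    (mem_Ici.2 (exp_one_le_four.trans (four_le_J hI hk))) (rpow_le_J I k)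

lemma log_J_div_J_pos (hI : I.Valid) {k : ℕ} (hk : 1 ≤ k) :
    0 < Real.log (I.J k) / I.J k := by
  have h4 := four_le_J hI hk
  exact div_pos (by linarith [one_le_log_of_four_le h4]) (by linarith)

lemma eta_pos (hP : P.Assumptions) (hI : I.Valid) {k : ℕ} (hk : 1 ≤ k) : 0 < eta P I k := by
  have h1 := hP.Lh_pos
  have h2 := hI.ηbar_pos
  have h3 := log_J_div_J_pos hI hk
  unfold eta
  positivity

/-- If `η_k ≤ η̄`, then `√κ_k ≤ J_k / (4 ln J_k)`, so `j` inner steps contract by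
`exp (-4 j ln J_k / J_k)`. -/
lemma one_sub_inv_sqrt_kappa_pow_le (hP : P.Assumptions) (hI : I.Valid) {k : ℕ} (hk : 1 ≤ k)
    (hη : eta P I k ≤ I.ηbar) {m j : ℕ} (hmj : (m : ℝ) * I.J k ≤ 4 * j) :
    (1 - 1 / Real.sqrt (kappa P I k)) ^ j ≤ ((I.J k : ℝ) ^ m)⁻¹ := by
  have h4 := four_le_J hI hk
  have hlog := one_le_log_of_four_le h4
  have hl := log_J_div_J_pos hI hk
  have hη0 := eta_pos hP hI hk
  have ht := one_lt_sqrt_kappa hP hη0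
  have htk := eta_mul_sqrt_kappa_sq hP hη0
  have hLh := hP.Lh_pos
  have heta : eta P I k = 16 * (P.Lh + I.ηbar) * (Real.log (I.J k) / (I.J k : ℝ)) ^ 2 := rfl
  set t := Real.sqrt (kappa P I k)
  set l := Real.log (I.J k) / (I.J k : ℝ) with hldef
  have hL : 0 < P.Lh + I.ηbar := by linarith [hI.ηbar_pos]
  -- `η t² = L_h + η ≤ L_h + η̄` with `η = 16 (L_h + η̄) l²`
  have h1 : (P.Lh + I.ηbar) * (4 * l * t) ^ 2 ≤ (P.Lh + I.ηbar) * 1 := by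
    rw [heta] at htk
    linarith
  have h2 : 4 * l * t ≤ 1 := by
    have := le_of_mul_le_mul_left h1 hL
    rwa [sq_le_one_iff₀ (by positivity)] at this
  have h3 : 4 * l ≤ 1 / t := by rwa [le_div_iff₀ (by linarith)]
  have h5 : 0 ≤ 1 - 1 / t := one_sub_inv_sqrt_kappa_nonneg hP hη0
  have h6 : 1 - 1 / t ≤ Real.exp (-(4 * l)) := by
    have := Real.add_one_le_exp (-(4 * l))
    linarith
  calc (1 - 1 / t) ^ j ≤ (Real.exp (-(4 * l))) ^ j := pow_le_pow_left₀ h5 h6 j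
    _ = Real.exp (-(l * (4 * j))) := by rw [← Real.exp_nat_mul]; congr 1; ring
    _ ≤ Real.exp (-(m * Real.log (I.J k))) := by
      apply Real.exp_le_exp.2
      have h7 : l * (m * I.J k) ≤ l * (4 * j) := mul_le_mul_of_nonneg_left hmj hl.le
      have h8 : l * (m * I.J k) = m * Real.log (I.J k) := by
        rw [hldef]; field_simp
      linarith
    _ = ((I.J k : ℝ) ^ m)⁻¹ := by
      rw [Real.exp_neg, Real.exp_nat_mul, Real.exp_log (by linarith)]

/-! ### Accuracy of the inner loop -/

lemma inv_J_pow_le (hI : I.Valid) {k : ℕ} (hk : 1 ≤ k) {m : ℕ} (hm : 2 ≤ m) :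
    ((I.J k : ℝ) ^ m)⁻¹ ≤ (Real.log (I.J k) / I.J k) ^ 2 := by
  have h4 := four_le_J hI hk
  have hlog := one_le_log_of_four_le h4
  rw [div_pow, ← one_div]
  gcongr
  · nlinarith
  · linarith

/-- Infeasibility of the output of the inner loop. The Lyapunov function is evaluated at the
projection of the starting point onto the lower-level solution set. -/
lemma infDist_innerX_sq_le (hP : P.Assumptions) (hI : I.Valid) {k : ℕ} (hk : 1 ≤ k)
    (hη : eta P I k ≤ I.ηbar) (z : E n) {x x₀ : E n} (hx : x ∈ P.sol) (hx₀ : x₀ ∈ P.dom) :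
    P.α * Metric.infDist (innerX P I k z x₀ (I.J k)) P.sol ^ 2
      ≤ 16 * (Real.log (I.J k) / I.J k) ^ 2 *
        ((P.Lh + I.ηbar) * (1 / 2 * ‖x₀ - z‖ ^ 2 + 1 / 2 * ‖x₀ - x‖ ^ 2)
          + (P.hb x₀ - P.hb x) + (P.Lh + I.ηbar) * (1 / 2 * ‖x - z‖ ^ 2)) := by
  have h4 := four_le_J hI hk
  have hη0 := eta_pos hP hI hk
  have h1 := innerObj_innerX_le hP hI hη0 z (hP.sol_subset_dom hx) hx₀ (I.J k)
  have h2 := one_sub_inv_sqrt_kappa_pow_le hP hI hk hη (m := 4) (j := I.J k) (by norm_num)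
  have hJ1 : 1 ≤ I.J k := by
    have : (1 : ℝ) ≤ I.J k := by linarith
    exact_mod_cast this
  have h3 := hP.growth hx (innerX_mem_dom hP hI k z x₀ hJ1)
  have h5 := inv_J_pow_le hI hk (m := 4) (by norm_num)
  have h6 : ((I.J k : ℝ) ^ 4)⁻¹ ≤ 1 := inv_le_one_of_one_le₀ (one_le_pow₀ (by linarith))
  have hb := hP.hb_le hx hx₀
  have heta : eta P I k = 16 * (P.Lh + I.ηbar) * (Real.log (I.J k) / (I.J k : ℝ)) ^ 2 := rfl
  set ρ := (1 - 1 / Real.sqrt (kappa P I k)) ^ (I.J k)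
  set η := eta P I k
  set l := Real.log (I.J k) / (I.J k : ℝ)
  have hρ : 0 ≤ ρ := pow_nonneg (one_sub_inv_sqrt_kappa_nonneg hP hη0) _
  have hl : 0 ≤ l ^ 2 := sq_nonneg l
  simp only [Problem.innerObj] at h1
  rw [norm_sub_rev x x₀] at h1
  set u := innerX P I k z x₀ (I.J k)
  have g1 : ρ * (P.hb x₀ - P.hb x) ≤ 16 * l ^ 2 * (P.hb x₀ - P.hb x) := by
    apply mul_le_mul_of_nonneg_right _ (by linarith)
    linarith
  have g2 : ρ * (η * (1 / 2 * ‖x₀ - z‖ ^ 2 + 1 / 2 * ‖x₀ - x‖ ^ 2))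
      ≤ 1 * (η * (1 / 2 * ‖x₀ - z‖ ^ 2 + 1 / 2 * ‖x₀ - x‖ ^ 2)) := by
    apply mul_le_mul_of_nonneg_right (h2.trans h6) (by positivity)
  have g3 : 0 ≤ ρ * (η * (1 / 2 * ‖x - z‖ ^ 2)) := by positivity
  have g4 : 0 ≤ η * (1 / 2 * ‖u - z‖ ^ 2) := by positivity
  calc P.α * Metric.infDist u P.sol ^ 2
      ≤ ρ * (P.hb x₀ - P.hb x) + ρ * (η * (1 / 2 * ‖x₀ - z‖ ^ 2 + 1 / 2 * ‖x₀ - x‖ ^ 2))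
        + η * (1 / 2 * ‖x - z‖ ^ 2) := by linarith
    _ ≤ 16 * l ^ 2 * (P.hb x₀ - P.hb x)
        + 1 * (η * (1 / 2 * ‖x₀ - z‖ ^ 2 + 1 / 2 * ‖x₀ - x‖ ^ 2))
        + η * (1 / 2 * ‖x - z‖ ^ 2) := by linarith
    _ = _ := by rw [heta]; ring

/-- The output of the inner loop is almost as close to `z` as any lower-level solution `x`. -/
lemma norm_innerX_sub_sq_le (hP : P.Assumptions) (hI : I.Valid) {k : ℕ} (hk : 1 ≤ k)
    (hη : eta P I k ≤ I.ηbar) (z : E n) {x x₀ : E n} (hx : x ∈ P.sol) (hx₀ : x₀ ∈ P.dom) :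
    1 / 2 * ‖innerX P I k z x₀ (I.J k) - z‖ ^ 2 - 1 / 2 * ‖x - z‖ ^ 2
      ≤ (2 * (1 / 2 * ‖x₀ - z‖ ^ 2 + 1 / 2 * ‖x₀ - x‖ ^ 2)
          + (P.hb x₀ - P.hb x) / (2 * (P.Lh + I.ηbar))) / (I.J k : ℝ) ^ 2 := by
  have h4 := four_le_J hI hk
  have hlog := one_le_log_of_four_le h4
  have hη0 := eta_pos hP hI hk
  have h1 := innerObj_innerX_le hP hI hη0 z (hP.sol_subset_dom hx) hx₀ (I.J k)
  have h2 := one_sub_inv_sqrt_kappa_pow_le hP hI hk hη (m := 4) (j := I.J k) (by norm_num)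
  have hJ1 : 1 ≤ I.J k := by
    have : (1 : ℝ) ≤ I.J k := by linarith
    exact_mod_cast this
  have h3 := hP.hb_le hx (innerX_mem_dom hP hI k z x₀ hJ1)
  have hb := hP.hb_le hx hx₀
  have hLh := hP.Lh_pos
  have hηb := hI.ηbar_pos
  have heta : eta P I k = 16 * (P.Lh + I.ηbar) * (Real.log (I.J k) / (I.J k : ℝ)) ^ 2 := rfl
  set ρ := (1 - 1 / Real.sqrt (kappa P I k)) ^ (I.J k)
  set η := eta P I k
  set J : ℝ := (I.J k : ℝ)
  have hρ : 0 ≤ ρ := pow_nonneg (one_sub_inv_sqrt_kappa_nonneg hP hη0) _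
  simp only [Problem.innerObj] at h1
  rw [norm_sub_rev x x₀] at h1
  set u := innerX P I k z x₀ (I.J k)
  have g0 : η * (1 / 2 * ‖u - z‖ ^ 2 - 1 / 2 * ‖x - z‖ ^ 2)
      ≤ (J ^ 4)⁻¹ * (P.hb x₀ - P.hb x + η * (1 / 2 * ‖x₀ - z‖ ^ 2 + 1 / 2 * ‖x₀ - x‖ ^ 2)) := by
    have a1 := mul_le_mul_of_nonneg_right h2
      (show 0 ≤ P.hb x₀ - P.hb x + η * (1 / 2 * ‖x₀ - z‖ ^ 2 + 1 / 2 * ‖x₀ - x‖ ^ 2) by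
        have := sub_nonneg.2 hb
        positivity)
    have a2 : 0 ≤ ρ * (η * (1 / 2 * ‖x - z‖ ^ 2)) := by positivity
    linarith
  have g1 : (J ^ 4)⁻¹ * (P.hb x₀ - P.hb x)
      ≤ η * ((P.hb x₀ - P.hb x) / (2 * (P.Lh + I.ηbar)) / J ^ 2) := by
    have e : η * ((P.hb x₀ - P.hb x) / (2 * (P.Lh + I.ηbar)) / J ^ 2)
        = (J ^ 4)⁻¹ * (P.hb x₀ - P.hb x) * (8 * Real.log J ^ 2) := by
      rw [heta]
      field_simp
      ring
    rw [e]
    have : 0 ≤ (J ^ 4)⁻¹ * (P.hb x₀ - P.hb x) := mul_nonneg (by positivity) (by linarith)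
    exact le_mul_of_one_le_right this (by nlinarith)
  have g2 : (J ^ 4)⁻¹ * (η * (1 / 2 * ‖x₀ - z‖ ^ 2 + 1 / 2 * ‖x₀ - x‖ ^ 2))
      ≤ η * (2 * (1 / 2 * ‖x₀ - z‖ ^ 2 + 1 / 2 * ‖x₀ - x‖ ^ 2) / J ^ 2) := by
    have a3 : (J ^ 4)⁻¹ ≤ (J ^ 2)⁻¹ := by
      apply inv_anti₀ (by positivity)
      exact pow_le_pow_right₀ (by linarith) (by norm_num)
    have a4 := mul_le_mul_of_nonneg_right a3
      (show 0 ≤ η * (1 / 2 * ‖x₀ - z‖ ^ 2 + 1 / 2 * ‖x₀ - x‖ ^ 2) by positivity)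
    refine a4.trans ?_
    have a5 : 0 ≤ η * (1 / 2 * ‖x₀ - z‖ ^ 2 + 1 / 2 * ‖x₀ - x‖ ^ 2) / J ^ 2 := by positivity
    have e : η * (2 * (1 / 2 * ‖x₀ - z‖ ^ 2 + 1 / 2 * ‖x₀ - x‖ ^ 2) / J ^ 2)
        = 2 * (η * (1 / 2 * ‖x₀ - z‖ ^ 2 + 1 / 2 * ‖x₀ - x‖ ^ 2) / J ^ 2) := by ring
    rw [e, inv_mul_eq_div]
    linarith
  refine le_of_mul_le_mul_left ?_ hη0
  rw [add_div, mul_add]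
  rw [mul_add] at g0
  linarith

/-- Accuracy of the inner loop from an arbitrary starting point: infeasibility of order
`ln J / J`, and optimality gap of order `1 / J` for the distance to `z`. -/
lemma innerX_rates (hP : P.Assumptions) (hI : I.Valid) {k : ℕ} (hk : 1 ≤ k)
    (hη : eta P I k ≤ I.ηbar) (z : E n) {x : E n} (hx : x ∈ P.sol) (x₀ : E n) :
    P.α * Metric.infDist (innerX P I k z x₀ (I.J k)) P.sol ^ 2
      ≤ 16 * (P.Lh + I.ηbar) * (Real.log (I.J k) / I.J k) ^ 2 *
        (‖x - z‖ ^ 2 + ‖x - x₀‖ ^ 2) ∧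
    1 / 2 * ‖innerX P I k z x₀ (I.J k) - z‖ ^ 2 - 1 / 2 * ‖x - z‖ ^ 2
      ≤ (‖x - z‖ ^ 2 + ‖x - x₀‖ ^ 2) / I.J k := by
  have h4 := four_le_J hI hk
  have hlog := one_le_log_of_four_le h4
  have hη0 := eta_pos hP hI hk
  obtain ⟨j, hj⟩ : ∃ j, I.J k = j + 1 := by
    refine Nat.exists_eq_add_of_le' ?_
    have : (1 : ℝ) ≤ I.J k := by linarith
    exact_mod_cast this
  have hjr : (I.J k : ℝ) = j + 1 := by exact_mod_cast hj
  have h1 := innerObj_innerX_le_of_mem_sol hP hI hη0 z hx x₀ j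
  rw [← hj] at h1
  have h2 := one_sub_inv_sqrt_kappa_pow_le hP hI hk hη (m := 3) (j := j) (by push_cast; linarith)
  have hud := innerX_mem_dom hP hI k z x₀ (j := I.J k) (by omega)
  have h3 := hP.growth hx hud
  have h3' := hP.hb_le hx hud
  have h5 := inv_J_pow_le hI hk (m := 3) (by norm_num)
  have hLh := hP.Lh_pos
  have hηb := hI.ηbar_pos
  have heta : eta P I k = 16 * (P.Lh + I.ηbar) * (Real.log (I.J k) / (I.J k : ℝ)) ^ 2 := rfl
  set ρ := (1 - 1 / Real.sqrt (kappa P I k)) ^ j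
  set η := eta P I k
  set u := innerX P I k z x₀ (I.J k)
  set J : ℝ := (I.J k : ℝ)
  have hJ0 : 0 < J := by linarith
  simp only [Problem.innerObj] at h1
  have g0 : P.hb u - P.hb x + η * (1 / 2 * ‖u - z‖ ^ 2) - η * (1 / 2 * ‖x - z‖ ^ 2)
      ≤ (J ^ 3)⁻¹ * (2 * (P.Lh + I.ηbar) * ‖x - x₀‖ ^ 2 + η * (1 / 2 * ‖x - z‖ ^ 2)) := by
    have a1 := mul_le_mul_of_nonneg_right h2
      (show 0 ≤ 2 * (P.Lh + η) * ‖x - x₀‖ ^ 2 + η * (1 / 2 * ‖x - z‖ ^ 2) by positivity)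
    have a2 : (J ^ 3)⁻¹ * (2 * (P.Lh + η) * ‖x - x₀‖ ^ 2 + η * (1 / 2 * ‖x - z‖ ^ 2))
        ≤ (J ^ 3)⁻¹ * (2 * (P.Lh + I.ηbar) * ‖x - x₀‖ ^ 2 + η * (1 / 2 * ‖x - z‖ ^ 2)) := by
      gcongr
    linarith
  constructor
  · have b1 : (J ^ 3)⁻¹ * (2 * (P.Lh + I.ηbar) * ‖x - x₀‖ ^ 2)
        ≤ (Real.log J / J) ^ 2 * (2 * (P.Lh + I.ηbar) * ‖x - x₀‖ ^ 2) :=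
      mul_le_mul_of_nonneg_right h5 (by positivity)
    have b2 : (J ^ 3)⁻¹ * (η * (1 / 2 * ‖x - z‖ ^ 2)) ≤ 1 * (η * (1 / 2 * ‖x - z‖ ^ 2)) :=
      mul_le_mul_of_nonneg_right (inv_le_one_of_one_le₀ (one_le_pow₀ (by linarith)))
        (by positivity)
    have b3 : 0 ≤ η * (1 / 2 * ‖u - z‖ ^ 2) := by positivity
    have b4 : 0 ≤ (Real.log J / J) ^ 2 * ((P.Lh + I.ηbar) * ‖x - x₀‖ ^ 2) := by positivity
    calc _ ≤ (Real.log J / J) ^ 2 * (2 * (P.Lh + I.ηbar) * ‖x - x₀‖ ^ 2)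
          + η * ‖x - z‖ ^ 2 := by linarith
      _ ≤ _ := by rw [heta]; linarith
  · have b1 : (J ^ 3)⁻¹ * (2 * (P.Lh + I.ηbar) * ‖x - x₀‖ ^ 2) ≤ η * (‖x - x₀‖ ^ 2 / J) := by
      have e : η * (‖x - x₀‖ ^ 2 / J)
          = (J ^ 3)⁻¹ * (2 * (P.Lh + I.ηbar) * ‖x - x₀‖ ^ 2) * (8 * Real.log J ^ 2) := by
        rw [heta]
        field_simp
        ring
      rw [e]
      have : 0 ≤ (J ^ 3)⁻¹ * (2 * (P.Lh + I.ηbar) * ‖x - x₀‖ ^ 2) := by positivity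
      exact le_mul_of_one_le_right this (by nlinarith)
    have b2 : (J ^ 3)⁻¹ * (η * (1 / 2 * ‖x - z‖ ^ 2)) ≤ η * (‖x - z‖ ^ 2 / J) := by
      have a3 : (J ^ 3)⁻¹ ≤ J⁻¹ :=
        inv_anti₀ hJ0 (le_self_pow₀ (by linarith) (by norm_num))
      have a4 := mul_le_mul_of_nonneg_right a3
        (show 0 ≤ η * (1 / 2 * ‖x - z‖ ^ 2) by positivity)
      refine a4.trans ?_
      have a5 : 0 ≤ η * (‖x - z‖ ^ 2 / J) := by positivity
      have e : J⁻¹ * (η * (1 / 2 * ‖x - z‖ ^ 2)) = 1 / 2 * (η * (‖x - z‖ ^ 2 / J)) := by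
        field_simp
      rw [e]
      linarith
    refine le_of_mul_le_mul_left ?_ hη0
    rw [add_div, mul_add]
    rw [mul_add] at g0
    linarith

/-! ### Indices with small regularization -/

lemma tendsto_J (hI : I.Valid) : Tendsto (fun k => (I.J k : ℝ)) atTop atTop := by
  refine tendsto_atTop_mono (rpow_le_J I) ?_
  refine (tendsto_rpow_atTop (by linarith [hI.two_le_a])).comp ?_
  exact tendsto_atTop_add_const_right _ _ tendsto_natCast_atTop_atTop

lemma tendsto_log_J_div_J (hI : I.Valid) :
    Tendsto (fun k => Real.log (I.J k) / (I.J k : ℝ)) atTop (𝓝 0) := by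
  have h := Real.isLittleO_log_id_atTop.tendsto_div_nhds_zero
  exact h.comp (tendsto_J hI)

lemma eventually_eta_le (hI : I.Valid) : ∀ᶠ k in atTop, eta P I k ≤ I.ηbar := by
  have h : Tendsto (fun k => eta P I k) atTop (𝓝 0) := by
    have := ((tendsto_log_J_div_J hI).pow 2).const_mul (16 * (P.Lh + I.ηbar))
    simpa [eta] using this
  exact h.eventually_le_const hI.ηbar_pos

lemma LargeEnough.eta_le (hP : P.Assumptions) (hI : I.Valid) {K k : ℕ} (hK : 2 ≤ K)
    (h : LargeEnough P I K) (hk : K / 2 ≤ k) : eta P I k ≤ I.ηbar := by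
  have hm : 1 ≤ K / 2 := by omega
  have hLh := hP.Lh_pos
  have hηb := hI.ηbar_pos
  have h4 := four_le_rpow hI hm
  have hle : (((K / 2 : ℕ) : ℝ) + 1) ^ I.a ≤ I.J k := by
    refine le_trans ?_ (rpow_le_J I k)
    apply Real.rpow_le_rpow (by positivity) _ (by linarith [hI.two_le_a])
    have : ((K / 2 : ℕ) : ℝ) ≤ k := by exact_mod_cast hk
    linarith
  have hl0 := log_J_div_J_pos hI (hm.trans hk)
  have h1 : Real.log (I.J k) / I.J k ≤
      (((((K / 2 : ℕ) : ℝ) + 1) ^ I.a / (I.a * Real.log (((K / 2 : ℕ) : ℝ) + 1))))⁻¹ := by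
    rw [inv_div, ← Real.log_rpow (by positivity)]
    exact Real.log_div_self_antitoneOn (mem_Ici.2 (exp_one_le_four.trans h4))
      (mem_Ici.2 (exp_one_le_four.trans (h4.trans hle))) hle
  unfold LargeEnough at h
  set q := (((K / 2 : ℕ) : ℝ) + 1) ^ I.a / (I.a * Real.log (((K / 2 : ℕ) : ℝ) + 1))
  have hq2 : 0 < q ^ 2 := lt_of_lt_of_le (by positivity) h
  have h2 : (Real.log (I.J k) / I.J k) ^ 2 ≤ (q ^ 2)⁻¹ := by
    rw [← inv_pow]
    exact pow_le_pow_left₀ hl0.le h1 2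
  have h3 : 16 * (P.Lh + I.ηbar) ≤ I.ηbar * q ^ 2 := by
    have := mul_le_mul_of_nonneg_left h hηb.le
    have e : I.ηbar * (16 + 16 * (P.Lh / I.ηbar)) = 16 * (P.Lh + I.ηbar) := by
      field_simp; ring
    linarith
  calc eta P I k = 16 * (P.Lh + I.ηbar) * (Real.log (I.J k) / (I.J k : ℝ)) ^ 2 := rfl
    _ ≤ I.ηbar * q ^ 2 * (q ^ 2)⁻¹ :=
      mul_le_mul h3 h2 (by positivity) (by positivity)
    _ = I.ηbar := mul_inv_cancel_right₀ hq2.ne' _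

/-! ### Descent of the outer iteration -/

lemma sq_le_two_mul_add_of_le {a b c : ℝ} (ha : 0 ≤ a) (h : a ≤ b + c) :
    a ^ 2 ≤ 2 * b ^ 2 + 2 * c ^ 2 := by
  have := pow_le_pow_left₀ ha h 2
  linarith [add_sq_le (a := b) (b := c)]

/-- One inexact projected gradient step `x ↦ x⁺`, where `x⁺` is within `δ` of being nearest to
`z = x - γ ∇f(x)` and both `x` and `x⁺` are only nearly feasible. -/
lemma residual_descent (hP : P.Assumptions) {γ δ B : ℝ} (hγ : 0 < γ) (hγL : γ * P.Lf ≤ 1 / 2)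
    (x x' : E n) (hB : ∀ q ∈ P.sol, ‖gradient P.f q‖ ≤ B)
    (hδ : 1 / 2 * ‖x' - (x - γ • gradient P.f x)‖ ^ 2
      - 1 / 2 * ‖proj P.sol (x - γ • gradient P.f x) - (x - γ • gradient P.f x)‖ ^ 2 ≤ δ) :
    3 / 8 * (γ ^ 2 * ‖P.residual γ x‖ ^ 2)
      ≤ γ * (P.f x - P.f x') + (Metric.infDist x P.sol ^ 2
        + γ * ‖gradient P.f x‖ * Metric.infDist x P.sol + δ
        + 1 / 2 * (δ + Metric.infDist x' P.sol * (3 / 2 * Metric.infDist x P.sol + γ * B))) := by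
  have hcl := hP.isClosed_sol
  have hne := hP.sol_nonempty
  have hG : γ ^ 2 * ‖P.residual γ x‖ ^ 2
      = ‖x - proj P.sol (x - γ • gradient P.f x)‖ ^ 2 := by
    rw [Problem.residual, norm_smul, Real.norm_of_nonneg (by positivity)]
    field_simp
  rw [hG]
  have hdesc := hP.f_smooth.le_quadratic x x'
  have hlip := hP.f_smooth.2 x (proj P.sol x)
  have hq := proj_mem hcl hne x
  have hBq := hB _ hq
  have hd := norm_sub_proj hcl hne x
  have hq' := proj_mem hcl hne x'
  have hd' := norm_sub_proj hcl hne x'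
  set g := gradient P.f x
  set z := x - γ • g with hz
  set q := proj P.sol x
  set q' := proj P.sol x'
  set p := proj P.sol z
  have hv1 : inner ℝ (z - p) (q - p) ≤ 0 := inner_sub_proj_le hcl hP.convex_sol z hq
  have hv2 : inner ℝ (z - p) (q' - p) ≤ 0 := inner_sub_proj_le hcl hP.convex_sol z hq'
  set d := Metric.infDist x P.sol
  set d' := Metric.infDist x' P.sol
  have hd0 : 0 ≤ d := Metric.infDist_nonneg
  have hd0' : 0 ≤ d' := Metric.infDist_nonneg
  have i1 : ‖q - z‖ ^ 2 = ‖q - p‖ ^ 2 + ‖p - z‖ ^ 2 - 2 * inner ℝ (z - p) (q - p) := by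
    rw [← sub_add_sub_cancel q p z, norm_add_sq_real, ← neg_sub z p, inner_neg_right,
      real_inner_comm (q - p)]
    ring
  have i2 : ∀ v : E n, ‖v - z‖ ^ 2
      = ‖v - x‖ ^ 2 + 2 * (γ * inner ℝ g (v - x)) + ‖γ • g‖ ^ 2 := by
    intro v
    have : v - z = (v - x) + γ • g := by rw [hz]; abel
    rw [this, norm_add_sq_real, inner_smul_right, real_inner_comm g]
  have i3 : inner ℝ g (q - x) ≤ ‖g‖ * d := by
    rw [← hd, norm_sub_rev x q]
    exact real_inner_le_norm _ _
  -- descent of `f`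
  have i4 : γ * P.f x' ≤ γ * P.f x + γ * inner ℝ g (x' - x) + 1 / 4 * ‖x' - x‖ ^ 2 := by
    have h1 := mul_le_mul_of_nonneg_left hdesc hγ.le
    have h2 := mul_le_mul_of_nonneg_right hγL (sq_nonneg ‖x' - x‖)
    linarith
  have i5 : ‖q - x‖ = d := by rw [norm_sub_rev]; exact hd
  have h1 := i2 q
  have h2 := i2 x'
  rw [i5] at h1
  have i6 := mul_le_mul_of_nonneg_left i3 hγ.le
  -- distance from `x'` to the exact projection
  have j1 : ‖p - z‖ ≤ 3 / 2 * d + γ * B := by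
    have a1 : ‖p - z‖ ≤ ‖q - z‖ := by
      apply le_of_sq_le_sq _ (norm_nonneg _)
      nlinarith [sq_nonneg ‖q - p‖]
    have a2 : ‖q - z‖ ≤ d + γ * ‖g‖ := by
      have : q - z = (q - x) + γ • g := by rw [hz]; abel
      rw [this, ← i5, ← Real.norm_of_nonneg hγ.le, ← norm_smul, Real.norm_of_nonneg hγ.le]
      exact norm_add_le _ _
    have a3 : ‖g‖ ≤ B + P.Lf * d := by
      have := norm_sub_norm_le g (gradient P.f q)
      rw [hd] at hlip
      linarith
    have a4 := mul_le_mul_of_nonneg_left a3 hγ.le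
    have a5 := mul_le_mul_of_nonneg_right hγL hd0
    linarith
  have j2 : ‖x' - p‖ ^ 2 ≤ 2 * δ + 2 * (d' * (3 / 2 * d + γ * B)) := by
    have a1 : ‖x' - z‖ ^ 2 = ‖x' - p‖ ^ 2 + ‖p - z‖ ^ 2 - 2 * inner ℝ (z - p) (x' - p) := by
      rw [← sub_add_sub_cancel x' p z, norm_add_sq_real, ← neg_sub z p, inner_neg_right,
        real_inner_comm (x' - p)]
      ring
    have a2 : inner ℝ (z - p) (x' - p) ≤ ‖p - z‖ * d' := by
      rw [← sub_add_sub_cancel x' q' p, inner_add_right, ← hd', norm_sub_rev p z]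
      linarith [real_inner_le_norm (z - p) (x' - q')]
    have a3 := mul_le_mul_of_nonneg_right j1 hd0'
    linarith
  -- `x - p` is controlled both by `q - p` and by `x' - x`
  have k1 : ‖x - p‖ ^ 2 ≤ 2 * d ^ 2 + 2 * ‖q - p‖ ^ 2 := by
    have a1 := norm_add_le (x - q) (q - p)
    rw [sub_add_sub_cancel, hd] at a1
    exact sq_le_two_mul_add_of_le (norm_nonneg _) a1
  have k2 : ‖x - p‖ ^ 2 ≤ 2 * ‖x' - x‖ ^ 2 + 2 * ‖x' - p‖ ^ 2 := by
    have a1 := norm_add_le (x - x') (x' - p)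
    rw [sub_add_sub_cancel, norm_sub_rev x x'] at a1
    exact sq_le_two_mul_add_of_le (norm_nonneg _) a1
  -- the weights `1/4` of `k1` and `1/8` of `k2` add up to `3/8`
  linarith only [hδ, h1, h2, i1, hv1, i4, i6, j2, k1, k2]

lemma xhat_succ (K k : ℕ) :
    xhat P I K (k + 1) = innerX P I k (zpt P I K k) (xinit P I K k) (I.J k) := rfl

lemma gammaHat_pos {K : ℕ} (hK : 1 ≤ K) : 0 < gammaHat K := by
  have : (0 : ℝ) < K := by exact_mod_cast hK
  unfold gammaHat
  positivity

lemma gammaHat_le_one {K : ℕ} (hK : 1 ≤ K) : gammaHat K ≤ 1 := by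
  have : (1 : ℝ) ≤ K := by exact_mod_cast hK
  unfold gammaHat
  rw [div_le_one (by positivity)]
  exact Real.one_le_sqrt.2 this

lemma gammaHat_sq {K : ℕ} : gammaHat K ^ 2 = 1 / K := by
  rw [gammaHat, div_pow, Real.sq_sqrt (Nat.cast_nonneg K), one_pow]

lemma Admissible.gammaHat_mul_Lf_le (hP : P.Assumptions) {K : ℕ} (hK : Admissible P K) :
    gammaHat K * P.Lf ≤ 1 / 2 := by
  have hLf := hP.Lf_pos
  have := mul_le_mul_of_nonneg_right hK.2 hLf.le
  have e : 1 / (2 * P.Lf) * P.Lf = 1 / 2 := by field_simp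
  linarith

lemma bestResidual_nonneg (K : ℕ) : 0 ≤ bestResidual P I K := by
  apply Real.sInf_nonneg
  rintro _ ⟨k, _, rfl⟩
  exact norm_nonneg _

lemma bestResidual_le {K k : ℕ} (h1 : K / 2 ≤ k) (h2 : k < K) :
    bestResidual P I K ≤ ‖P.residual (gammaHat K) (xhat P I K k)‖ :=
  csInf_le ⟨0, by rintro _ ⟨k, _, rfl⟩; exact norm_nonneg _⟩ ⟨k, ⟨h1, h2⟩, rfl⟩

/-- Summing the descent inequality over `⌊K/2⌋ < k < K`, a range of at least `K/3` indices. The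
index `⌊K/2⌋` is left out because the infeasibility of `x̂_{⌊K/2⌋}` stems from an inner loop with a
possibly large regularization parameter. -/
lemma bestResidual_sq_le (hP : P.Assumptions) {K : ℕ} (hK : Admissible P K) (hK6 : 6 ≤ K)
    {Bs B D δ d : ℝ} (hBs : ∀ q ∈ P.sol, ‖gradient P.f q‖ ≤ Bs)
    (hB : ∀ k, K / 2 < k → k < K → ‖gradient P.f (xhat P I K k)‖ ≤ B)
    (hD : P.f (xhat P I K (K / 2 + 1)) ≤ D)
    (hd : ∀ k, K / 2 < k → k ≤ K → Metric.infDist (xhat P I K k) P.sol ≤ d)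
    (hδ : ∀ k, K / 2 < k → k < K → 1 / 2 * ‖xhat P I K (k + 1) - zpt P I K k‖ ^ 2
      - 1 / 2 * ‖proj P.sol (zpt P I K k) - zpt P I K k‖ ^ 2 ≤ δ) :
    bestResidual P I K ^ 2 ≤ 8 * (D - ⨅ x, P.f x) / Real.sqrt K
      + 8 / 3 * K * (d ^ 2 + gammaHat K * B * d + δ
        + 1 / 2 * (δ + d * (3 / 2 * d + gammaHat K * Bs))) := by
  have hγ := gammaHat_pos hK.1
  have hγL := hK.gammaHat_mul_Lf_le hP
  have hγ2 : gammaHat K ^ 2 = 1 / K := gammaHat_sq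
  set γ := gammaHat K with hγdef
  have hBs0 : 0 ≤ Bs := by
    obtain ⟨q, hq⟩ := hP.sol_nonempty
    exact (norm_nonneg _).trans (hBs q hq)
  set e := d ^ 2 + γ * B * d + δ + 1 / 2 * (δ + d * (3 / 2 * d + γ * Bs))
  have hstep : ∀ k, K / 2 < k → k < K → 3 / 8 * (γ ^ 2 * bestResidual P I K ^ 2)
      ≤ γ * (P.f (xhat P I K k) - P.f (xhat P I K (k + 1))) + e := by
    intro k h1 h2
    have a1 := residual_descent hP hγ hγL (xhat P I K k) (xhat P I K (k + 1)) hBs (hδ k h1 h2)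
    have a2 := pow_le_pow_left₀ (bestResidual_nonneg K) (bestResidual_le (P := P) (I := I) h1.le h2)
      2
    have a3 := hd k h1 h2.le
    have a4 := hd (k + 1) (by omega) h2
    have a5 := hB k h1 h2
    have a6 : 0 ≤ Metric.infDist (xhat P I K k) P.sol := Metric.infDist_nonneg
    have a7 : 0 ≤ Metric.infDist (xhat P I K (k + 1)) P.sol := Metric.infDist_nonneg
    have a8 : 0 ≤ B := (norm_nonneg _).trans a5
    have a9 : 0 ≤ d := a6.trans a3
    refine (mul_le_mul_of_nonneg_left (mul_le_mul_of_nonneg_left a2 (sq_nonneg γ))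
      (by norm_num)).trans (a1.trans ?_)
    simp only [e]
    gcongr
  have hsum : ∀ N, K / 2 + 1 + N ≤ K → N * (3 / 8 * (γ ^ 2 * bestResidual P I K ^ 2))
      ≤ γ * (P.f (xhat P I K (K / 2 + 1)) - P.f (xhat P I K (K / 2 + 1 + N))) + N * e := by
    intro N
    induction N with
    | zero => intro _; simp
    | succ N ih =>
      intro hN
      have a1 := ih (by omega)
      have a2 := hstep (K / 2 + 1 + N) (by omega) (by omega)
      rw [add_assoc (K / 2 + 1) N 1] at a2
      push_cast
      linarith
  have hN := hsum (K - (K / 2 + 1)) (by omega)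
  set N := K - (K / 2 + 1) with hNdef
  -- this is where `6 ≤ K` is needed
  have hN3 : (K : ℝ) ≤ 3 * N := by
    have : K ≤ 3 * N := by omega
    exact_mod_cast this
  have hK0 : (0 : ℝ) < K := by exact_mod_cast hK.1
  have hN0 : (0 : ℝ) < N := by linarith
  set Δ := D - ⨅ x, P.f x
  have hDC : P.f (xhat P I K (K / 2 + 1)) - P.f (xhat P I K (K / 2 + 1 + N)) ≤ Δ := by
    have := ciInf_le hP.f_bddBelow (xhat P I K (K / 2 + 1 + N))
    change _ ≤ D - _
    linarith
  have hΔ : 0 ≤ Δ := by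
    have := ciInf_le hP.f_bddBelow (xhat P I K (K / 2 + 1))
    change 0 ≤ D - _
    linarith
  have h1 := hN.trans (add_le_add_left (mul_le_mul_of_nonneg_left hDC hγ.le) _)
  rw [hγ2] at h1
  have h2 : 8 * Δ / Real.sqrt K = 8 * γ * Δ := by
    rw [hγdef, gammaHat]; ring
  rw [h2]
  refine le_of_mul_le_mul_left ?_ (show 0 < N * (3 / 8 * (1 / (K : ℝ))) by positivity)
  have h3 : γ * Δ ≤ 3 * N * (1 / K) * (γ * Δ) := by
    apply le_mul_of_one_le_left (by positivity)
    rw [mul_one_div, one_le_div hK0]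
    exact hN3
  have h4 : N * (3 / 8 * (1 / (K : ℝ))) * (8 * γ * Δ + 8 / 3 * K * e)
      = 3 * N * (1 / K) * (γ * Δ) + N * e := by
    field_simp
  rw [h4]
  linarith

/-! ### The explicit bounds -/

lemma Consts.Bounds.xinit_mem_dom (hP : P.Assumptions) {c : Consts} {K : ℕ}
    (hc : c.Bounds P I K) {k : ℕ} (h1 : 1 ≤ k) (h2 : k < K) : xinit P I K k ∈ P.dom := by
  by_contra hd
  obtain ⟨x, hx⟩ := hP.sol_nonempty
  have h := hc.T2_le k h1 h2
  rw [T2, Problem.hbar_eq_top hd, hP.hstar_eq hx, EReal.top_sub_coe, top_le_iff] at h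
  exact EReal.coe_ne_top _ h

lemma T2_eq (hP : P.Assumptions) {K k : ℕ} {x : E n} (hx : x ∈ P.sol)
    (hd : xinit P I K k ∈ P.dom) :
    T2 P I K k = ((P.hb (xinit P I K k) - P.hb x : ℝ) : EReal) := by
  rw [T2, Problem.hbar_eq hP.ω_pcc hd, hP.hstar_eq hx, ← EReal.coe_sub]

lemma T5_eq (hP : P.Assumptions) {K k : ℕ} {x : E n} (hx : x ∈ P.sol)
    (hd : xinit P I K k ∈ P.dom) :
    T5 P I K k
      = (((P.hb (xinit P I K k) - P.hb x) / (2 * (P.Lh + I.ηbar)) : ℝ) : EReal) := by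
  rw [T5, T2_eq hP hx hd, ← EReal.coe_div]

lemma Consts.Bounds.nonneg (hP : P.Assumptions) (hI : I.Valid) {c : Consts} {K : ℕ}
    (hc : c.Bounds P I K) (hK : 2 ≤ K) :
    0 ≤ c.M1 + c.M2 + c.M3 ∧ 0 ≤ c.M4 + c.M5 ∧ 0 ≤ c.Bhat := by
  have hLh := hP.Lh_pos
  have hηb := hI.ηbar_pos
  obtain ⟨x, hx⟩ := hP.sol_nonempty
  have hd := hc.xinit_mem_dom hP le_rfl hK
  have h1 := hc.T1_le 1 le_rfl hK
  have h2 := hc.T2_le 1 le_rfl hK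
  have h3 := hc.T3_le 1 le_rfl hK
  have h4 := hc.T4_le 1 le_rfl hK
  have h5 := hc.T5_le 1 le_rfl hK
  have h6 := hc.grad_le 1 le_rfl (by omega)
  rw [T2_eq hP hx hd, EReal.coe_le_coe_iff] at h2
  rw [T5_eq hP hx hd, EReal.coe_le_coe_iff] at h5
  have hb := sub_nonneg.2 (hP.hb_le hx hd)
  have t1 : 0 ≤ T1 P I K 1 := by unfold T1 fs; positivity
  have t3 : 0 ≤ T3 P I K 1 := by unfold T3 fs; positivity
  have t4 : 0 ≤ T4 P I K 1 := by unfold T4 fs; positivity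
  have t5 : 0 ≤ (P.hb (xinit P I K 1) - P.hb x) / (2 * (P.Lh + I.ηbar)) := by positivity
  exact ⟨by linarith, by linarith, (norm_nonneg _).trans h6⟩

lemma infDist_xhat_succ_le (hP : P.Assumptions) (hI : I.Valid) {c : Consts} {K k : ℕ}
    (hc : c.Bounds P I K) (h1 : 1 ≤ k) (h2 : k < K) (hη : eta P I k ≤ I.ηbar) :
    Metric.infDist (xhat P I K (k + 1)) P.sol ≤
      4 * Real.sqrt (P.α⁻¹ * (c.M1 + c.M2 + c.M3)) *
        (I.a * Real.log ((k : ℝ) + 1) / ((k : ℝ) + 1) ^ I.a) := by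
  have hd := hc.xinit_mem_dom hP h1 h2
  have hx := proj_mem hP.isClosed_sol hP.sol_nonempty (xinit P I K k)
  have hdist := norm_sub_proj hP.isClosed_sol hP.sol_nonempty (xinit P I K k)
  have h := infDist_innerX_sq_le hP hI h1 hη (zpt P I K k) hx hd
  have t1 := hc.T1_le k h1 h2
  have t2 := hc.T2_le k h1 h2
  have t3 := hc.T3_le k h1 h2
  rw [T2_eq hP hx hd, EReal.coe_le_coe_iff] at t2
  rw [T1, fs] at t1
  rw [T3, fs] at t3
  rw [hdist, ← xhat_succ] at h
  have hM := (hc.nonneg hP hI (by omega)).1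
  have hl := log_J_div_J_le hI h1
  have hl0 := log_J_div_J_pos hI h1
  set l := Real.log (I.J k) / (I.J k : ℝ)
  set r := I.a * Real.log ((k : ℝ) + 1) / ((k : ℝ) + 1) ^ I.a
  set M := c.M1 + c.M2 + c.M3
  have hα := hP.α_pos
  have h3 : P.α * Metric.infDist (xhat P I K (k + 1)) P.sol ^ 2 ≤ 16 * l ^ 2 * M :=
    h.trans (mul_le_mul_of_nonneg_left (by linarith) (by positivity))
  have h4 : 16 * l ^ 2 * M ≤ 16 * r ^ 2 * M := by gcongr
  have hr : 0 ≤ r := hl0.le.trans hl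
  apply le_of_sq_le_sq _ (by positivity)
  rw [mul_pow, mul_pow, Real.sq_sqrt (by positivity)]
  refine le_of_mul_le_mul_left ((h3.trans h4).trans_eq ?_) hα
  field_simp
  ring

lemma norm_gradient_le_gradSup (hP : P.Assumptions) (I : Input n) {q : E n} (hq : q ∈ P.sol)
    (hbox : Bornology.IsBounded I.box) : ‖gradient P.f q‖ ≤ gradSup P I := by
  refine le_csSup ?_ ⟨q, Or.inr hq, rfl⟩
  have hcomp : IsCompact (closure (I.box ∪ P.sol)) :=
    (hbox.union hP.sol_bounded).isCompact_closure
  have h := hcomp.bddAbove_image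
    (f := fun x => ‖gradient P.f x‖) hP.f_smooth.continuous_gradient.norm.continuousOn
  exact h.mono (image_mono subset_closure)

lemma box_eq (I : Input n) :
    I.box = (EuclideanSpace.equiv (Fin n) ℝ) ⁻¹' (Icc (fun i => I.lo i) (fun i => I.hi i)) := by
  ext x
  simp [Input.box, Pi.le_def, forall_and]

lemma isCompact_box (I : Input n) : IsCompact I.box := by
  rw [box_eq]
  exact (EuclideanSpace.equiv (Fin n) ℝ).toHomeomorph.isCompact_preimage.2 isCompact_Icc

lemma box_nonempty (hI : I.Valid) : I.box.Nonempty := ⟨I.lo, fun i => ⟨le_rfl, hI.box_le i⟩⟩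

/-- The arithmetic behind the explicit residual bound: here `γ = 1/√K`, `r = (2/K)^a`, the
infeasibilities are at most `s r`, and the inexactness of each step is at most `m r`. Young's inequality with weight `L γ` splits off the gradient
term. -/
lemma explicit_error_le {K L γ B Bs s r m cδ : ℝ} (hL : 0 < L) (hγ : 0 < γ)
    (hKγ : K * γ ^ 2 = 1) (hγL : γ * L ≤ 1 / 2) (hBs : 0 ≤ Bs) (hs : 0 ≤ s)
    (hr : 0 ≤ r) (hr1 : r ≤ 1) (hm : 0 ≤ m) (hcδ : m + 2 * s ^ 2 + 2 * γ * Bs * s = cδ) :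
    8 / 3 * K * ((s * r) ^ 2 + γ * B * (s * r) + m * r
        + 1 / 2 * (m * r + s * r * (3 / 2 * (s * r) + γ * Bs)))
      ≤ 2 * L * B ^ 2 * γ + 2 * K / (L * γ) * r * (s ^ 2 + cδ) := by
  have hK : K = 1 / γ ^ 2 := by field_simp; linarith
  have hK0 : 0 < K := by rw [hK]; positivity
  have hcδ0 : 0 ≤ cδ := by rw [← hcδ]; positivity
  have hY : γ * B * (s * r) ≤ L * γ / 2 * (γ * B) ^ 2 + 1 / (2 * (L * γ)) * (s * r) ^ 2 := by
    have e : L * γ / 2 * (γ * B) ^ 2 + 1 / (2 * (L * γ)) * (s * r) ^ 2 - γ * B * (s * r)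
        = 1 / (2 * (L * γ)) * (L * γ * (γ * B) - s * r) ^ 2 := by
      field_simp
      ring
    have : 0 ≤ 1 / (2 * (L * γ)) * (L * γ * (γ * B) - s * r) ^ 2 := by positivity
    linarith
  have hrr : (s * r) ^ 2 ≤ s ^ 2 * r := by
    have := mul_le_mul_of_nonneg_left hr1 (show 0 ≤ s ^ 2 * r by positivity)
    linarith
  have hrest : (s * r) ^ 2 + m * r + 1 / 2 * (m * r + s * r * (3 / 2 * (s * r) + γ * Bs))
      ≤ 3 / 2 * (r * cδ) := by
    rw [← hcδ]
    have : 0 ≤ r * (γ * Bs * s) := by positivity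
    have : 0 ≤ r * s ^ 2 := by positivity
    linarith
  have hinv : 2 ≤ 1 / (L * γ) := by
    rw [le_div_iff₀ (by positivity)]
    linarith
  have h1 : 8 / 3 * K * (L * γ / 2 * (γ * B) ^ 2) = 4 / 3 * (L * B ^ 2 * γ) * (K * γ ^ 2) := by
    ring
  rw [hKγ] at h1
  have h2 : 8 / 3 * K * (1 / (2 * (L * γ)) * (s * r) ^ 2)
      ≤ 8 / 3 * K * (1 / (2 * (L * γ)) * (s ^ 2 * r)) := by gcongr
  have h3 : 2 * K * (r * cδ) * 2 ≤ 2 * K * (r * cδ) * (1 / (L * γ)) := by gcongr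
  have h4 : 0 ≤ L * B ^ 2 * γ := by positivity
  have h5 : 0 ≤ K / (L * γ) * (s ^ 2 * r) := by positivity
  have h6 := mul_le_mul_of_nonneg_left hrest (show 0 ≤ 8 / 3 * K by positivity)
  have h7 := mul_le_mul_of_nonneg_left hY (show 0 ≤ 8 / 3 * K by positivity)
  have e1 : 2 * K / (L * γ) * r * (s ^ 2 + cδ)
      = 2 * (K / (L * γ) * (s ^ 2 * r)) + 2 * K * (r * cδ) * (1 / (L * γ)) := by ring
  have e2 : 8 / 3 * K * (1 / (2 * (L * γ)) * (s ^ 2 * r))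
      = 4 / 3 * (K / (L * γ) * (s ^ 2 * r)) := by
    field_simp
    ring
  rw [e1]
  linarith

/-- The quantity `(2/K)^a` compared with the explicit constant of the residual bound. -/
lemma two_div_rpow_le {a K : ℝ} (ha : 2 ≤ a) (hK : 0 < K) :
    2 * K * Real.sqrt K * (2 / K) ^ a
      ≤ 320 * (3 : ℝ) ^ a / (a - 1) * (1 / K ^ (a - 3 / 2)) := by
  have h1 : 1 + a * (1 / 2) ≤ (1 + 1 / 2 : ℝ) ^ a :=
    one_add_mul_self_le_rpow_one_add (by norm_num) (by linarith)
  have h3 : (3 : ℝ) ^ a = 2 ^ a * (1 + 1 / 2 : ℝ) ^ a := by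
    rw [← Real.mul_rpow (by norm_num) (by norm_num)]
    norm_num
  have hKa : K ^ (a - 3 / 2) * (K * Real.sqrt K) = K ^ a := by
    rw [Real.sqrt_eq_rpow, ← Real.rpow_one_add' hK.le (by norm_num), ← Real.rpow_add hK]
    norm_num
  have h2 : (0 : ℝ) < 2 ^ a := by positivity
  have hK1 : 0 < K ^ (a - 3 / 2) := by positivity
  have hs : 0 < Real.sqrt K := by positivity
  rw [Real.div_rpow zero_le_two hK.le, ← hKa, h3]
  have e : 2 * K * Real.sqrt K * (2 ^ a / (K ^ (a - 3 / 2) * (K * Real.sqrt K)))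
      = 2 * 2 ^ a * (1 / K ^ (a - 3 / 2)) := by field_simp
  rw [e]
  apply mul_le_mul_of_nonneg_right _ (by positivity)
  rw [le_div_iff₀ (by linarith)]
  nlinarith

lemma bestResidual_sq_le_explicit (hP : P.Assumptions) (hI : I.Valid) {K : ℕ}
    (hK : Admissible P K) (hK6 : 6 ≤ K) (hlarge : LargeEnough P I K) {c : Consts}
    (hc : c.Bounds P I K) :
    bestResidual P I K ^ 2 ≤
      8 * (c.Dhat - ⨅ x, P.f x) / Real.sqrt K + 2 * P.Lf * c.Bhat ^ 2 / Real.sqrt K +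
        320 * (cE P I c K + cDelta P I c K) * (3 : ℝ) ^ I.a /
          (P.Lf * (I.a - 1)) * (1 / (K : ℝ) ^ (I.a - 3 / 2)) := by
  have hK0 : (0 : ℝ) < K := by exact_mod_cast hK.1
  have hK6' : (6 : ℝ) ≤ K := by exact_mod_cast hK6
  have hα := hP.α_pos
  have hLf := hP.Lf_pos
  have ha := hI.two_le_a
  have hγ := gammaHat_pos hK.1
  obtain ⟨hM, hM45, hB0⟩ := hc.nonneg hP hI (by omega)
  have hgrad := fun q (hq : q ∈ P.sol) =>
    norm_gradient_le_gradSup hP I hq (isCompact_box I).isBounded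
  have hBs0 : 0 ≤ gradSup P I := by
    obtain ⟨q, hq⟩ := hP.sol_nonempty
    exact (norm_nonneg _).trans (hgrad q hq)
  have hη : ∀ k, K / 2 ≤ k → eta P I k ≤ I.ηbar := fun k hk =>
    hlarge.eta_le hP hI (by omega) hk
  have hcE : Real.sqrt (cE P I c K)
      = 4 * Real.sqrt (P.α⁻¹ * (c.M1 + c.M2 + c.M3)) * (I.a * Real.log K) := by
    have hlog : 0 ≤ Real.log K := Real.log_nonneg (by linarith)
    rw [Real.sqrt_eq_iff_eq_sq (by unfold cE; positivity) (by positivity), mul_pow, mul_pow,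
      Real.sq_sqrt (by positivity), cE]
    ring
  have hcE0 : 0 ≤ cE P I c K := by unfold cE; positivity
  set s := Real.sqrt (cE P I c K) with hs
  have hs0 : 0 ≤ s := Real.sqrt_nonneg _
  set r := (2 / (K : ℝ)) ^ I.a with hr
  have hr0 : 0 ≤ r := by positivity
  have hpow : ∀ k : ℕ, K / 2 < k → 1 / (k : ℝ) ^ I.a ≤ r := by
    intro k hk
    have h2k : (K : ℝ) ≤ 2 * k := by
      have : K ≤ 2 * k := by omega
      exact_mod_cast this
    have hk0 : (0 : ℝ) < k := by linarith
    rw [hr, Real.div_rpow zero_le_two hK0.le, div_le_div_iff₀ (by positivity) (by positivity),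
      one_mul, ← Real.mul_rpow zero_le_two (Nat.cast_nonneg k)]
    exact Real.rpow_le_rpow hK0.le h2k (by linarith)
  -- `(K/2)^a ≥ 3^a ≥ a` produces the factor `1/a` in front of `M₄ + M₅`
  have hr3 : r ≤ 1 / I.a := by
    have h1 : 1 + I.a * 2 ≤ (1 + 2 : ℝ) ^ I.a :=
      one_add_mul_self_le_rpow_one_add (by norm_num) (by linarith)
    have h2 : r * (3 : ℝ) ^ I.a ≤ 1 := by
      rw [hr, ← Real.mul_rpow (by positivity) (by norm_num)]
      apply Real.rpow_le_one (by positivity) _ (by linarith)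
      rw [div_mul_eq_mul_div, div_le_one hK0]
      linarith
    norm_num at h1
    rw [le_div_iff₀ (by linarith)]
    nlinarith
  have hr1 : r ≤ 1 := hr3.trans (by rw [div_le_one (by linarith)]; linarith)
  have hd : ∀ k, K / 2 < k → k ≤ K → Metric.infDist (xhat P I K k) P.sol ≤ s * r := by
    intro k h1 h2
    obtain ⟨j, rfl⟩ : ∃ j, k = j + 1 := Nat.exists_eq_add_of_le' (by omega)
    refine (infDist_xhat_succ_le hP hI hc (by omega) (by omega) (hη j (by omega))).trans ?_
    have a1 := hpow (j + 1) h1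
    push_cast at a1
    have a2 : Real.log ((j : ℝ) + 1) ≤ Real.log K := by
      apply Real.log_le_log (by positivity)
      exact_mod_cast h2
    rw [hcE, div_eq_mul_one_div, ← mul_assoc]
    have a3 : 0 ≤ Real.log K := Real.log_nonneg (by linarith)
    gcongr
  have hδ : ∀ k, K / 2 < k → k < K → 1 / 2 * ‖xhat P I K (k + 1) - zpt P I K k‖ ^ 2
      - 1 / 2 * ‖proj P.sol (zpt P I K k) - zpt P I K k‖ ^ 2 ≤ (c.M4 + c.M5) / I.a * r := by
    intro k h1 h2
    have hk1 : 1 ≤ k := by omega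
    have hdom := hc.xinit_mem_dom hP hk1 h2
    have hx := proj_mem hP.isClosed_sol hP.sol_nonempty (zpt P I K k)
    refine (norm_innerX_sub_sq_le hP hI hk1 (hη k h1.le) (zpt P I K k) hx hdom).trans ?_
    have t4 := hc.T4_le k hk1 h2
    have t5 := hc.T5_le k hk1 h2
    rw [T5_eq hP hx hdom, EReal.coe_le_coe_iff] at t5
    rw [T4, fs] at t4
    have a1 : 1 / (I.J k : ℝ) ≤ r := by
      have b1 := hpow (k + 1) (by omega)
      push_cast at b1
      refine le_trans ?_ b1
      exact one_div_le_one_div_of_le (by positivity) (rpow_le_J I k)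
    have a2 : 1 / (I.J k : ℝ) ^ 2 ≤ 1 / I.a * r := by
      rw [← one_div_pow, sq]
      exact mul_le_mul (a1.trans hr3) a1 (by positivity) (by positivity)
    rw [div_eq_mul_one_div _ ((I.J k : ℝ) ^ 2)]
    calc _ ≤ (c.M4 + c.M5) * (1 / (I.J k : ℝ) ^ 2) := by gcongr
      _ ≤ (c.M4 + c.M5) * (1 / I.a * r) := by gcongr
      _ = _ := by ring
  have hbest := bestResidual_sq_le hP hK hK6 (Bs := gradSup P I) (B := c.Bhat) (D := c.Dhat)
    hgrad (fun k h1 h2 => hc.grad_le k (by omega) h2.le)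
    ((le_abs_self _).trans (hc.f_le _ (by omega) (by omega))) hd hδ
  have hγL := hK.gammaHat_mul_Lf_le hP
  have herr := explicit_error_le (K := K) (B := c.Bhat) (cδ := cDelta P I c K) hLf hγ
    (by rw [gammaHat_sq]; field_simp) hγL hBs0 hs0 hr0 hr1
    (show 0 ≤ (c.M4 + c.M5) / I.a by positivity)
    (by rw [cDelta, hs, Real.sq_sqrt hcE0])
  rw [hs, Real.sq_sqrt hcE0, ← hs] at herr
  have hcδ0 : 0 ≤ cDelta P I c K := by unfold cDelta; positivity
  have hfin : 2 * K / (P.Lf * gammaHat K) * r * (cE P I c K + cDelta P I c K)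
      ≤ 320 * (cE P I c K + cDelta P I c K) * (3 : ℝ) ^ I.a /
          (P.Lf * (I.a - 1)) * (1 / (K : ℝ) ^ (I.a - 3 / 2)) := by
    have h := mul_le_mul_of_nonneg_right (two_div_rpow_le ha hK0)
      (show 0 ≤ (cE P I c K + cDelta P I c K) / P.Lf by positivity)
    have e1 : 2 * K / (P.Lf * gammaHat K) * r * (cE P I c K + cDelta P I c K)
        = 2 * K * Real.sqrt K * r * ((cE P I c K + cDelta P I c K) / P.Lf) := by
      rw [gammaHat]; field_simp
    have e2 : 320 * (cE P I c K + cDelta P I c K) * (3 : ℝ) ^ I.a /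
          (P.Lf * (I.a - 1)) * (1 / (K : ℝ) ^ (I.a - 3 / 2))
        = 320 * (3 : ℝ) ^ I.a / (I.a - 1) * (1 / (K : ℝ) ^ (I.a - 3 / 2))
          * ((cE P I c K + cDelta P I c K) / P.Lf) := by
      have : I.a - 1 ≠ 0 := by linarith
      field_simp
    rw [e1, e2]
    exact h
  have e3 : 2 * P.Lf * c.Bhat ^ 2 * gammaHat K = 2 * P.Lf * c.Bhat ^ 2 / Real.sqrt K := by
    rw [gammaHat]; ring
  rw [e3] at herr
  linarith

/-! ### Uniform boundedness of the iterates -/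

lemma IsSmooth.norm_gradient_le {f : E n → ℝ} {L : ℝ} (hf : IsSmooth L f) (x y : E n) :
    ‖gradient f x‖ ≤ ‖gradient f y‖ + L * ‖x - y‖ := by
  have h1 := hf.2 x y
  have h2 := norm_sub_norm_le (gradient f x) (gradient f y)
  linarith

/-- Finitely many inner steps map bounded sets of data to bounded sets. -/
lemma exists_norm_innerX_le (hP : P.Assumptions) (hI : I.Valid) (k : ℕ) (R : ℝ) (j : ℕ) :
    ∃ D, ∀ z x₀ : E n, ‖z‖ ≤ R → ‖x₀‖ ≤ R → ‖innerX P I k z x₀ j‖ ≤ D := by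
  suffices h : ∃ D, ∀ z x₀ : E n, ‖z‖ ≤ R → ‖x₀‖ ≤ R →
      ‖((innerStep P I k z)^[j] (x₀, x₀)).1‖ ≤ D ∧
      ‖((innerStep P I k z)^[j] (x₀, x₀)).2‖ ≤ D by
    obtain ⟨D, hD⟩ := h
    exact ⟨D, fun z x₀ hz hx => (hD z x₀ hz hx).1⟩
  induction j with
  | zero => exact ⟨R, fun z x₀ _ hx => ⟨hx, hx⟩⟩
  | succ j ih =>
    obtain ⟨D, hD⟩ := ih
    set γ := gammaIn P I k with hγ
    set η := eta P I k
    have hγ0 : 0 < γ := gammaIn_pos hP hI k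
    have hη0 : 0 ≤ η := eta_nonneg hP hI k
    have hLh := hP.Lh_pos
    set β := (Real.sqrt (kappa P I k) - 1) / (Real.sqrt (kappa P I k) + 1)
    set p := prox (fun u => (γ : EReal) * P.ω u) 0
    let D₁ : ℝ := ‖p‖ + (D + γ * ((‖gradient P.h 0‖ + P.Lh * D) + η * (D + R)))
    refine ⟨max D₁ (D₁ + |β| * (D₁ + D)), fun z x₀ hz hx => ?_⟩
    obtain ⟨h1, h2⟩ := hD z x₀ hz hx
    rw [Function.iterate_succ_apply']
    set s := (innerStep P I k z)^[j] (x₀, x₀)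
    have hu : ‖(innerStep P I k z s).1‖ ≤ D₁ := by
      have a1 := hP.norm_prox_sub_prox_le hγ0 (s.2 - γ • (gradient P.h s.2 + η • (s.2 - z))) 0
      have a2 := norm_sub_norm_le
        (prox (fun u => (γ : EReal) * P.ω u) (s.2 - γ • (gradient P.h s.2 + η • (s.2 - z)))) p
      rw [sub_zero] at a1
      have a3 := norm_sub_le s.2 (γ • (gradient P.h s.2 + η • (s.2 - z)))
      have a4 := norm_add_le (gradient P.h s.2) (η • (s.2 - z))
      have a5 := norm_sub_le s.2 z
      have a6 := hP.h_smooth.norm_gradient_le s.2 0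
      rw [sub_zero] at a6
      rw [norm_smul, Real.norm_of_nonneg hγ0.le] at a3
      rw [norm_smul, Real.norm_of_nonneg hη0] at a4
      have a7 : ‖gradient P.h s.2 + η • (s.2 - z)‖
          ≤ (‖gradient P.h 0‖ + P.Lh * D) + η * (D + R) := by
        refine a4.trans (add_le_add (a6.trans ?_) ?_)
        · gcongr
        · exact mul_le_mul_of_nonneg_left (by linarith) hη0
      have a8 := mul_le_mul_of_nonneg_left a7 hγ0.le
      change ‖prox (fun u => (γ : EReal) * P.ω u)
        (s.2 - γ • (gradient P.h s.2 + η • (s.2 - z)))‖ ≤ _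
      simp only [D₁]
      linarith
    refine ⟨hu.trans (le_max_left _ _), le_trans ?_ (le_max_right _ _)⟩
    change ‖(innerStep P I k z s).1 + β • ((innerStep P I k z s).1 - s.1)‖ ≤ _
    refine (norm_add_le _ _).trans (add_le_add hu ?_)
    rw [norm_smul, Real.norm_eq_abs]
    exact mul_le_mul_of_nonneg_left ((norm_sub_le _ _).trans (add_le_add hu h1)) (abs_nonneg β)

lemma xinit_succ_mem_box (hI : I.Valid) (K k : ℕ) : xinit P I K (k + 1) ∈ I.box :=
  proj_mem (isCompact_box I).isClosed (box_nonempty hI) _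

lemma norm_zpt_sub_le (hP : P.Assumptions) {K : ℕ} (hK : 1 ≤ K) (k : ℕ) (x : E n) :
    ‖zpt P I K k - x‖ ≤ (1 + P.Lf) * ‖xhat P I K k - x‖ + ‖gradient P.f x‖ := by
  have h1 := hP.f_smooth.norm_gradient_le (xhat P I K k) x
  have h2 := norm_sub_le (xhat P I K k - x) (gammaHat K • gradient P.f (xhat P I K k))
  rw [norm_smul, Real.norm_of_nonneg (gammaHat_pos hK).le] at h2
  have h3 : gammaHat K * ‖gradient P.f (xhat P I K k)‖ ≤ 1 * ‖gradient P.f (xhat P I K k)‖ :=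
    mul_le_mul_of_nonneg_right (gammaHat_le_one hK) (norm_nonneg _)
  have h4 : zpt P I K k - x
      = xhat P I K k - x - gammaHat K • gradient P.f (xhat P I K k) := by
    rw [zpt]; abel
  rw [h4]
  linarith

/-- For a fixed index `k`, the iterates `x̂_k` of all runs lie in a common bounded set. -/
lemma exists_norm_xhat_le_fixed (hP : P.Assumptions) (hI : I.Valid) (k : ℕ) :
    ∃ D, ∀ K, 1 ≤ K → ‖xhat P I K k‖ ≤ D ∧ ‖xinit P I K k‖ ≤ D := by
  induction k with
  | zero =>
    exact ⟨max ‖I.xhat0‖ ‖I.x00‖, fun K _ => ⟨le_max_left _ _, le_max_right _ _⟩⟩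
  | succ k ih =>
    obtain ⟨D, hD⟩ := ih
    obtain ⟨B, hB⟩ := (isCompact_box I).isBounded.exists_norm_le
    have hLf := hP.Lf_pos
    obtain ⟨D', hD'⟩ := exists_norm_innerX_le hP hI k
      (max D ((1 + P.Lf) * D + ‖gradient P.f 0‖)) (I.J k)
    refine ⟨max D' B, fun K hK => ⟨?_, ?_⟩⟩
    · obtain ⟨h1, h2⟩ := hD K hK
      refine (hD' _ _ ?_ (h2.trans (le_max_left _ _))).trans (le_max_left _ _)
      have h3 := norm_zpt_sub_le (I := I) hP hK k 0
      rw [sub_zero, sub_zero] at h3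
      refine h3.trans (le_trans ?_ (le_max_right _ _))
      gcongr
    · exact (hB _ (xinit_succ_mem_box hI K k)).trans (le_max_right _ _)

/-- Infeasibility bound at a fixed reference solution `x`. -/
lemma infDist_xhat_succ_le_of_mem_sol (hP : P.Assumptions) (hI : I.Valid) {K k : ℕ}
    (hk : 1 ≤ k) (hη : eta P I k ≤ I.ηbar) {x : E n} (hx : x ∈ P.sol) :
    Metric.infDist (xhat P I K (k + 1)) P.sol
      ≤ Real.sqrt (16 * (P.Lh + I.ηbar) / P.α) * (Real.log (I.J k) / I.J k) *
        (‖zpt P I K k - x‖ + ‖xinit P I K k - x‖) := by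
  have h := (innerX_rates hP hI hk hη (zpt P I K k) hx (xinit P I K k)).1
  rw [← xhat_succ, norm_sub_rev x, norm_sub_rev x] at h
  have hl := log_J_div_J_pos hI hk
  have hα := hP.α_pos
  have hLh := hP.Lh_pos
  have hηb := hI.ηbar_pos
  apply le_of_sq_le_sq _ (by positivity)
  rw [mul_pow, mul_pow, Real.sq_sqrt (by positivity)]
  refine le_of_mul_le_mul_left (h.trans ?_) hα
  set l := Real.log (I.J k) / (I.J k : ℝ)
  have e : P.α * (16 * (P.Lh + I.ηbar) / P.α * l ^ 2 *
      (‖zpt P I K k - x‖ + ‖xinit P I K k - x‖) ^ 2)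
      = 16 * (P.Lh + I.ηbar) * l ^ 2 * (‖zpt P I K k - x‖ + ‖xinit P I K k - x‖) ^ 2 := by
    field_simp
  rw [e]
  gcongr
  nlinarith [norm_nonneg (zpt P I K k - x), norm_nonneg (xinit P I K k - x)]

/-- The iterates of all runs lie in a common bounded set: for large `k` the inner loop returns to a
neighbourhood of the bounded set `X*`, up to an error `O(ln J_k / J_k)` times the size of `x̂_k`. -/
lemma exists_norm_xhat_le (hP : P.Assumptions) (hI : I.Valid) :
    ∃ D, ∀ K, 1 ≤ K → ∀ k, ‖xhat P I K k‖ ≤ D := by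
  obtain ⟨x, hx⟩ := hP.sol_nonempty
  obtain ⟨R, hR⟩ := hP.sol_bounded.exists_norm_le
  obtain ⟨B, hB⟩ := (isCompact_box I).isBounded.exists_norm_le
  have hLf := hP.Lf_pos
  set c := Real.sqrt (16 * (P.Lh + I.ηbar) / P.α)
  have hc : 0 ≤ c := Real.sqrt_nonneg _
  have htend : Tendsto (fun k => c * (Real.log (I.J k) / (I.J k : ℝ)) * (1 + P.Lf)) atTop
      (𝓝 0) := by
    simpa using ((tendsto_log_J_div_J hI).const_mul c).mul_const (1 + P.Lf)
  obtain ⟨k₀, hk₀⟩ := eventually_atTop.1 (((eventually_eta_le (P := P) hI).and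
    (htend.eventually_le_const (by norm_num : (0 : ℝ) < 1 / 2))).and (eventually_ge_atTop 1))
  choose D hD using exists_norm_xhat_le_fixed hP hI
  obtain ⟨M, hM⟩ := ((finite_Iic k₀).image D).bddAbove
  have hM' : ∀ k, k ≤ k₀ → D k ≤ M := fun k hk => hM ⟨k, hk, rfl⟩
  set G := ‖gradient P.f x‖
  -- `U` dominates the fixed point of `u ↦ (R + ‖x‖) + (u + G + B + ‖x‖) / 2`
  let U : ℝ := max (M + ‖x‖) (2 * (R + ‖x‖) + G + (B + ‖x‖))
  have hrec : ∀ K, 1 ≤ K → ∀ k, k₀ ≤ k → ‖xhat P I K k - x‖ ≤ U := by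
    intro K hK k hk
    induction k, hk using Nat.le_induction with
    | base =>
      refine le_trans ?_ (le_max_left _ _)
      exact (norm_sub_le _ _).trans (add_le_add ((hD k₀ K hK).1.trans (hM' _ le_rfl)) le_rfl)
    | succ k hk ih =>
      obtain ⟨⟨h1, h2⟩, h3⟩ := hk₀ k hk
      have a1 := infDist_xhat_succ_le_of_mem_sol (K := K) hP hI h3 h1 hx
      have a2 := norm_zpt_sub_le (I := I) hP hK k x
      have a3 : ‖xinit P I K k - x‖ ≤ B + ‖x‖ := by
        obtain ⟨i, rfl⟩ := Nat.exists_eq_add_of_le' h3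
        exact (norm_sub_le _ _).trans
          (add_le_add (hB _ (xinit_succ_mem_box hI K i)) le_rfl)
      have a4 := norm_sub_proj hP.isClosed_sol hP.sol_nonempty (xhat P I K (k + 1))
      have a5 := hR _ (proj_mem hP.isClosed_sol hP.sol_nonempty (xhat P I K (k + 1)))
      have a6 : ‖xhat P I K (k + 1) - x‖
          ≤ Metric.infDist (xhat P I K (k + 1)) P.sol + (R + ‖x‖) := by
        rw [← a4, ← sub_add_sub_cancel _ (proj P.sol (xhat P I K (k + 1))) x]
        exact (norm_add_le _ _).trans
          (add_le_add le_rfl ((norm_sub_le _ _).trans (add_le_add a5 le_rfl)))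
      set ε := c * (Real.log (I.J k) / (I.J k : ℝ))
      have hε : 0 ≤ ε := mul_nonneg hc (log_J_div_J_pos hI h3).le
      have a7 : ε ≤ 1 / 2 := le_trans (le_mul_of_one_le_right hε (by linarith)) h2
      have a8 : ε * (‖zpt P I K k - x‖ + ‖xinit P I K k - x‖)
          ≤ ε * (((1 + P.Lf) * U + G) + (B + ‖x‖)) := by
        refine mul_le_mul_of_nonneg_left (add_le_add (a2.trans ?_) a3) hε
        gcongr
      have hU0 : 0 ≤ U := (norm_nonneg _).trans ih
      have a9 := mul_le_mul_of_nonneg_right h2 hU0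
      have hGB : 0 ≤ G + (B + ‖x‖) :=
        add_nonneg (norm_nonneg _) ((norm_nonneg _).trans a3)
      have a10 := mul_le_mul_of_nonneg_right a7 hGB
      have a11 : 2 * (R + ‖x‖) + G + (B + ‖x‖) ≤ U := le_max_right _ _
      linarith
  refine ⟨max M (U + ‖x‖), fun K hK k => ?_⟩
  rcases le_total k k₀ with h | h
  · exact ((hD k K hK).1.trans (hM' k h)).trans (le_max_left _ _)
  · refine le_trans ?_ (le_max_right _ _)
    have := norm_sub_norm_le (xhat P I K k) x
    linarith [hrec K hK k h]

lemma exists_norm_zpt_le (hP : P.Assumptions) (hI : I.Valid) :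
    ∃ D, ∀ K, 1 ≤ K → ∀ k, ‖zpt P I K k‖ ≤ D := by
  obtain ⟨D, hD⟩ := exists_norm_xhat_le hP hI
  have hLf := hP.Lf_pos
  refine ⟨(1 + P.Lf) * D + ‖gradient P.f 0‖, fun K hK k => ?_⟩
  have h := norm_zpt_sub_le (I := I) hP hK k 0
  rw [sub_zero, sub_zero] at h
  refine h.trans ?_
  gcongr
  exact hD K hK k

lemma exists_norm_gradient_xhat_le (hP : P.Assumptions) (hI : I.Valid) :
    ∃ B, ∀ K, 1 ≤ K → ∀ k, ‖gradient P.f (xhat P I K k)‖ ≤ B := by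
  obtain ⟨D, hD⟩ := exists_norm_xhat_le hP hI
  have hLf := hP.Lf_pos
  refine ⟨‖gradient P.f 0‖ + P.Lf * D, fun K hK k => ?_⟩
  have h := hP.f_smooth.norm_gradient_le (xhat P I K k) 0
  rw [sub_zero] at h
  refine h.trans ?_
  gcongr
  exact hD K hK k

lemma exists_abs_f_xhat_le (hP : P.Assumptions) (hI : I.Valid) :
    ∃ M, ∀ K, 1 ≤ K → ∀ k, |P.f (xhat P I K k)| ≤ M := by
  obtain ⟨D, hD⟩ := exists_norm_xhat_le hP hI
  obtain ⟨M, hM⟩ := (isCompact_closedBall (0 : E n) D).exists_bound_of_continuousOn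
    hP.f_smooth.1.continuous.continuousOn
  exact ⟨M, fun K hK k => hM _ (mem_closedBall_zero_iff.2 (hD K hK k))⟩

/-! ### Convergence rates -/

/-- Infeasibility and inexactness of the outer steps with large index, uniformly over all runs. -/
lemma exists_outer_rates (hP : P.Assumptions) (hI : I.Valid) :
    ∃ C : ℝ, ∃ k₀ : ℕ, 0 ≤ C ∧ 1 ≤ k₀ ∧ ∀ K, 1 ≤ K → ∀ k, k₀ ≤ k →
      Metric.infDist (xhat P I K (k + 1)) P.sol ≤ C * (Real.log (I.J k) / I.J k) ∧
      1 / 2 * ‖xhat P I K (k + 1) - zpt P I K k‖ ^ 2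
        - 1 / 2 * ‖proj P.sol (zpt P I K k) - zpt P I K k‖ ^ 2 ≤ C / I.J k := by
  obtain ⟨k₀, hk₀⟩ := eventually_atTop.1
    ((eventually_eta_le (P := P) hI).and (eventually_ge_atTop 1))
  obtain ⟨R, hR⟩ := hP.sol_bounded.exists_norm_le
  obtain ⟨B, hB⟩ := (isCompact_box I).isBounded.exists_norm_le
  obtain ⟨Z, hZ⟩ := exists_norm_zpt_le hP hI
  have hR0 : 0 ≤ R := by
    obtain ⟨x, hx⟩ := hP.sol_nonempty
    exact (norm_nonneg _).trans (hR x hx)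
  have hB0 : 0 ≤ B := by
    obtain ⟨x, hx⟩ := box_nonempty hI
    exact (norm_nonneg _).trans (hB x hx)
  have hZ0 : 0 ≤ Z := (norm_nonneg _).trans (hZ 1 le_rfl 0)
  set c := Real.sqrt (16 * (P.Lh + I.ηbar) / P.α)
  have hc : 0 ≤ c := Real.sqrt_nonneg _
  refine ⟨max (c * (Z + R + (B + R))) ((R + Z) ^ 2 + (R + B) ^ 2), max k₀ 1,
    le_max_of_le_left (by positivity), le_max_right _ _, fun K hK k hk => ?_⟩
  obtain ⟨hη, h1⟩ := hk₀ k ((le_max_left _ _).trans hk)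
  have hx := proj_mem hP.isClosed_sol hP.sol_nonempty (zpt P I K k)
  set p := proj P.sol (zpt P I K k)
  have a1 := infDist_xhat_succ_le_of_mem_sol (K := K) hP hI h1 hη hx
  have a2 := (innerX_rates hP hI h1 hη (zpt P I K k) hx (xinit P I K k)).2
  have hx0 : ‖xinit P I K k‖ ≤ B := by
    obtain ⟨i, rfl⟩ := Nat.exists_eq_add_of_le' h1
    exact hB _ (xinit_succ_mem_box hI K i)
  have b1 : ‖zpt P I K k - p‖ ≤ Z + R :=
    (norm_sub_le _ _).trans (add_le_add (hZ K hK k) (hR p hx))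
  have b2 : ‖xinit P I K k - p‖ ≤ B + R :=
    (norm_sub_le _ _).trans (add_le_add hx0 (hR p hx))
  have b3 : ‖p - zpt P I K k‖ ≤ R + Z :=
    (norm_sub_le _ _).trans (add_le_add (hR p hx) (hZ K hK k))
  have b4 : ‖p - xinit P I K k‖ ≤ R + B :=
    (norm_sub_le _ _).trans (add_le_add (hR p hx) hx0)
  have hl := log_J_div_J_pos hI h1
  constructor
  · calc _ ≤ _ := a1
      _ ≤ c * (Real.log (I.J k) / I.J k) * (Z + R + (B + R)) := by gcongr
      _ = c * (Z + R + (B + R)) * (Real.log (I.J k) / I.J k) := by ring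
      _ ≤ _ := mul_le_mul_of_nonneg_right (le_max_left _ _) hl.le
  · refine a2.trans ?_
    gcongr
    refine le_trans ?_ (le_max_right _ _)
    gcongr

/-- A bound that holds for all large `K` extends, with another constant, to all `K`. -/
lemma exists_forall_le_mul {S : ℕ → Prop} {u v : ℕ → ℝ} (hv : ∀ K, S K → 0 < v K) {C : ℝ}
    {K₀ : ℕ} (h : ∀ K, S K → K₀ ≤ K → u K ≤ C * v K) :
    ∃ C', ∀ K, S K → u K ≤ C' * v K := by
  obtain ⟨M, hM⟩ := ((finite_Iio K₀).image fun K => u K / v K).bddAbove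
  refine ⟨max C M, fun K hK => ?_⟩
  rcases lt_or_ge K K₀ with hlt | hge
  · have h1 : u K / v K ≤ M := hM ⟨K, hlt, rfl⟩
    rw [← div_le_iff₀ (hv K hK)]
    exact h1.trans (le_max_right _ _)
  · exact (h K hK hge).trans (mul_le_mul_of_nonneg_right (le_max_left _ _) (hv K hK).le)

lemma exists_infDist_xhat_le (hP : P.Assumptions) (hI : I.Valid) :
    ∃ C : ℝ, ∀ K : ℕ, 2 ≤ K →
      Metric.infDist (xhat P I K K) P.sol ≤ C * (Real.log K / (K : ℝ) ^ I.a) := by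
  obtain ⟨C, k₀, hC, hk₀, h⟩ := exists_outer_rates hP hI
  refine exists_forall_le_mul (S := fun K => 2 ≤ K) (C := C * I.a) (K₀ := k₀ + 1)
    (fun K hK => ?_) fun K hK hge => ?_
  · have hK' : (2 : ℝ) ≤ K := by exact_mod_cast hK
    have := Real.log_pos (show (1 : ℝ) < K by linarith)
    positivity
  · obtain ⟨k, rfl⟩ : ∃ k, K = k + 1 := Nat.exists_eq_add_of_le' (by omega)
    have h1 := (h (k + 1) (by omega) k (by omega)).1
    have h2 := log_J_div_J_le hI (k := k) (by omega)
    push_cast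
    calc _ ≤ _ := h1
      _ ≤ C * (I.a * Real.log ((k : ℝ) + 1) / ((k : ℝ) + 1) ^ I.a) := by gcongr
      _ = _ := by ring

lemma sq_le_J (hI : I.Valid) (k : ℕ) : ((k : ℝ) + 1) ^ 2 ≤ I.J k := by
  refine le_trans ?_ (rpow_le_J I k)
  rw [← Real.rpow_two]
  exact Real.rpow_le_rpow_of_exponent_le (by linarith [(Nat.cast_nonneg k : (0 : ℝ) ≤ k)])
    hI.two_le_a

lemma log_J_div_J_le_two_div (hI : I.Valid) (k : ℕ) :
    Real.log (I.J k) / I.J k ≤ 2 / ((k : ℝ) + 1) := by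
  have h1 := sq_le_J hI k
  have hk : (0 : ℝ) < (k : ℝ) + 1 := by positivity
  have hJ : (0 : ℝ) < I.J k := lt_of_lt_of_le (by positivity) h1
  have h2 : Real.log (I.J k) ≤ 2 * Real.sqrt (I.J k) := by
    have h3 := Real.log_le_self (Real.sqrt_nonneg (I.J k))
    rw [Real.log_sqrt hJ.le] at h3
    linarith
  have h4 : (k : ℝ) + 1 ≤ Real.sqrt (I.J k) := Real.le_sqrt_of_sq_le h1
  have h5 := Real.mul_self_sqrt hJ.le
  rw [div_le_div_iff₀ hJ hk]
  calc Real.log (I.J k) * ((k : ℝ) + 1) ≤ 2 * Real.sqrt (I.J k) * Real.sqrt (I.J k) := by gcongr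
    _ = 2 * I.J k := by rw [mul_assoc, h5]

/-- The squared residual decays at the rate `1/√K`: since `a ≥ 2`, infeasibility and inexactness at
the indices `k > K/2` are of order `1/K` and `1/K²`, so that they do not affect the rate. -/
lemma exists_bestResidual_sq_le (hP : P.Assumptions) (hI : I.Valid) :
    ∃ C : ℝ, ∀ K : ℕ, Admissible P K → bestResidual P I K ^ 2 ≤ C * (1 / Real.sqrt K) := by
  obtain ⟨C, k₀, hC, hk₀, h⟩ := exists_outer_rates hP hI
  obtain ⟨B, hB⟩ := exists_norm_gradient_xhat_le hP hI
  obtain ⟨D, hD⟩ := exists_abs_f_xhat_le hP hI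
  have hgrad := fun q (hq : q ∈ P.sol) =>
    norm_gradient_le_gradSup hP I hq (isCompact_box I).isBounded
  set Bs := gradSup P I
  have hBs0 : 0 ≤ Bs := by
    obtain ⟨q, hq⟩ := hP.sol_nonempty
    exact (norm_nonneg _).trans (hgrad q hq)
  have hB0 : 0 ≤ B := (norm_nonneg _).trans (hB 1 le_rfl 0)
  refine exists_forall_le_mul (S := Admissible P) (K₀ := 2 * k₀ + 6)
    (C := 8 * (D - ⨅ x, P.f x)
      + 8 / 3 * (28 * C ^ 2 + 4 * C * B + 6 * C + 2 * C * Bs))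
    (fun K hK => ?_) fun K hK hge => ?_
  · have : (0 : ℝ) < K := by exact_mod_cast hK.1
    positivity
  have hK0 : (0 : ℝ) < K := by exact_mod_cast hK.1
  have hinv : ∀ k : ℕ, K / 2 ≤ k → 1 / ((k : ℝ) + 1) ≤ 2 / K := by
    intro k hk
    have : K ≤ 2 * (k + 1) := by omega
    have : (K : ℝ) ≤ 2 * ((k : ℝ) + 1) := by exact_mod_cast this
    rw [div_le_div_iff₀ (by positivity) hK0]
    linarith
  have hd : ∀ k, K / 2 < k → k ≤ K → Metric.infDist (xhat P I K k) P.sol ≤ 4 * C / K := by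
    intro k h1 h2
    obtain ⟨j, rfl⟩ : ∃ j, k = j + 1 := Nat.exists_eq_add_of_le' (by omega)
    calc _ ≤ _ := (h K hK.1 j (by omega)).1
      _ ≤ C * (2 / ((j : ℝ) + 1)) :=
        mul_le_mul_of_nonneg_left (log_J_div_J_le_two_div hI j) hC
      _ = 2 * C * (1 / ((j : ℝ) + 1)) := by ring
      _ ≤ 2 * C * (2 / K) := by
        gcongr 2 * C * ?_
        exact hinv j (by omega)
      _ = _ := by ring
  have hδ : ∀ k, K / 2 < k → k < K → 1 / 2 * ‖xhat P I K (k + 1) - zpt P I K k‖ ^ 2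
      - 1 / 2 * ‖proj P.sol (zpt P I K k) - zpt P I K k‖ ^ 2 ≤ 4 * C / (K : ℝ) ^ 2 := by
    intro k h1 h2
    calc _ ≤ _ := (h K hK.1 k (by omega)).2
      _ ≤ C / ((k : ℝ) + 1) ^ 2 := by
        gcongr
        exact sq_le_J hI k
      _ = C * (1 / ((k : ℝ) + 1)) ^ 2 := by rw [one_div_pow, mul_one_div]
      _ ≤ C * (2 / K) ^ 2 := by
        gcongr C * ?_ ^ 2
        exact hinv k h1.le
      _ = _ := by ring
  have hbest := bestResidual_sq_le hP hK (by omega) (Bs := Bs) (B := B) (D := D) hgrad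
    (fun k _ _ => hB K hK.1 k) ((le_abs_self _).trans (hD K hK.1 _)) hd hδ
  have hγ : gammaHat K = 1 / Real.sqrt K := rfl
  have hKγ : 1 / (K : ℝ) ≤ gammaHat K := by
    rw [← gammaHat_sq, sq]
    exact mul_le_of_le_one_left (gammaHat_pos hK.1).le (gammaHat_le_one hK.1)
  rw [← hγ]
  have e1 : 8 * (D - ⨅ x, P.f x) / Real.sqrt K = 8 * (D - ⨅ x, P.f x) * gammaHat K := by
    rw [hγ]; ring
  have e2 : 8 / 3 * K * ((4 * C / K) ^ 2 + gammaHat K * B * (4 * C / K) + 4 * C / (K : ℝ) ^ 2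
        + 1 / 2 * (4 * C / (K : ℝ) ^ 2 + 4 * C / K * (3 / 2 * (4 * C / K) + gammaHat K * Bs)))
      = 8 / 3 * ((28 * C ^ 2 + 6 * C) * (1 / K) + (4 * C * B + 2 * C * Bs) * gammaHat K) := by
    field_simp
    ring
  rw [e1, e2] at hbest
  have h3 := mul_le_mul_of_nonneg_left hKγ (show 0 ≤ 28 * C ^ 2 + 6 * C by positivity)
  linarith

/-! ### Existence of bounds for all runs -/

/-- A box is the convex hull of its finitely many vertices. -/
lemma box_eq_convexHull (hI : I.Valid) :
    ∃ V : Set (E n), V.Finite ∧ I.box = convexHull ℝ V := by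
  let e := (EuclideanSpace.equiv (Fin n) ℝ).symm.toLinearEquiv
  let V : Set (Fin n → ℝ) := univ.pi fun i => {I.lo i, I.hi i}
  refine ⟨e.toLinearMap '' V, (Finite.pi fun i => toFinite _).image _, ?_⟩
  rw [← LinearMap.image_convexHull, convexHull_pi, box_eq, ← pi_univ_Icc]
  have h : ∀ i, convexHull ℝ {I.lo i, I.hi i} = Icc (I.lo i) (I.hi i) := fun i => by
    rw [convexHull_pair, segment_eq_Icc (hI.box_le i)]
  simp only [h]
  exact (EuclideanSpace.equiv (Fin n) ℝ).toEquiv.symm.image_eq_preimage_symm _ |>.symm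

/-- A convex function that is finite on a box is bounded above on it, by its values at the
vertices. -/
lemma exists_hb_le_on_box (hP : P.Assumptions) (hI : I.Valid) (hbox : I.box ⊆ P.dom) :
    ∃ W, ∀ x ∈ I.box, P.hb x ≤ W := by
  obtain ⟨V, hV, hVbox⟩ := box_eq_convexHull hI
  have hVd : V ⊆ P.dom := (subset_convexHull ℝ V).trans (hVbox ▸ hbox)
  obtain ⟨W, hW⟩ := (hV.image P.hb).bddAbove
  have hconv : ConvexOn ℝ P.dom P.hb :=
    (hP.h_convex.subset (subset_univ _) (Problem.convexOn_w hP.ω_pcc).1).add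
      (Problem.convexOn_w hP.ω_pcc)
  refine ⟨W, fun x hx => ?_⟩
  obtain ⟨y, hy, hxy⟩ := hconv.exists_ge_of_mem_convexHull hVd (hVbox ▸ hx)
  exact hxy.trans (hW ⟨y, hy, rfl⟩)

lemma exists_bounds (hP : P.Assumptions) (hI : I.Valid) (hbox : I.box ⊆ P.dom) :
    ∃ c : Consts, ∀ K : ℕ, Admissible P K → c.Bounds P I K := by
  obtain ⟨x, hx⟩ := hP.sol_nonempty
  obtain ⟨R, hR⟩ := hP.sol_bounded.exists_norm_le
  obtain ⟨B, hB⟩ := (isCompact_box I).isBounded.exists_norm_le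
  obtain ⟨Z, hZ⟩ := exists_norm_zpt_le hP hI
  obtain ⟨G, hG⟩ := exists_norm_gradient_xhat_le hP hI
  obtain ⟨F, hF⟩ := exists_abs_f_xhat_le hP hI
  obtain ⟨W, hW⟩ := exists_hb_le_on_box hP hI hbox
  have hLh := hP.Lh_pos
  have hηb := hI.ηbar_pos
  have hinit : ∀ K k, 1 ≤ k → xinit P I K k ∈ I.box := by
    intro K k hk
    obtain ⟨i, rfl⟩ := Nat.exists_eq_add_of_le' hk
    exact xinit_succ_mem_box hI K i
  have hproj : ∀ v, ‖proj P.sol v‖ ≤ R := fun v =>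
    hR _ (proj_mem hP.isClosed_sol hP.sol_nonempty v)
  have hsub : ∀ {u v : E n} {r s : ℝ}, ‖u‖ ≤ r → ‖v‖ ≤ s → ‖u - v‖ ≤ r + s := fun hu hv =>
    (norm_sub_le _ _).trans (add_le_add hu hv)
  refine ⟨⟨(P.Lh + I.ηbar) * (1 / 2 * (B + Z) ^ 2 + 1 / 2 * (B + R) ^ 2), W - P.hb x,
    (P.Lh + I.ηbar) * (1 / 2 * (R + Z) ^ 2),
    2 * (1 / 2 * (B + Z) ^ 2 + 1 / 2 * (B + R) ^ 2),
    (W - P.hb x) / (2 * (P.Lh + I.ηbar)), G, F⟩, fun K hK => ?_⟩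
  have hZK := hZ K hK.1
  constructor
  · intro k hk _
    have h1 := hsub (hB _ (hinit K k hk)) (hZK k)
    have h2 := hsub (hB _ (hinit K k hk)) (hproj (xinit P I K k))
    rw [norm_sub_proj hP.isClosed_sol hP.sol_nonempty] at h2
    have h3 : 0 ≤ Metric.infDist (xinit P I K k) P.sol := Metric.infDist_nonneg
    simp only [T1, fs]
    gcongr
  · intro k hk _
    rw [T2_eq hP hx (hbox (hinit K k hk)), EReal.coe_le_coe_iff]
    linarith [hW _ (hinit K k hk)]
  · intro k hk _
    have h1 := hsub (hproj (xinit P I K k)) (hZK k)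
    simp only [T3, fs]
    gcongr
  · intro k hk _
    have h1 := hsub (hB _ (hinit K k hk)) (hZK k)
    have h2 := hsub (hB _ (hinit K k hk)) (hproj (zpt P I K k))
    simp only [T4, fs]
    gcongr
  · intro k hk _
    rw [T5_eq hP hx (hbox (hinit K k hk)), EReal.coe_le_coe_iff]
    exact div_le_div_of_nonneg_right (sub_le_sub_right (hW _ (hinit K k hk)) _) (by positivity)
  · exact fun k _ _ => hG K hK.1 k
  · exact fun k _ _ => hF K hK.1 k

/-! ### Iteration complexity -/

lemma sum_J_le (hI : I.Valid) {N : ℕ} (hN : 1 ≤ N) :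
    ((∑ k ∈ Finset.range N, I.J k : ℕ) : ℝ) ≤ 2 * (N : ℝ) ^ (I.a + 1) := by
  have ha := hI.two_le_a
  have hN1 : (1 : ℝ) ≤ N := by exact_mod_cast hN
  have hterm : ∀ k ∈ Finset.range N, (I.J k : ℝ) ≤ 2 * (N : ℝ) ^ I.a := by
    intro k hk
    have h1 : (I.J k : ℝ) < ((k : ℝ) + 1) ^ I.a + 1 := Nat.ceil_lt_add_one (by positivity)
    have h2 : ((k : ℝ) + 1) ^ I.a ≤ (N : ℝ) ^ I.a := by
      apply Real.rpow_le_rpow (by positivity) _ (by linarith)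
      exact_mod_cast Finset.mem_range.1 hk
    have h3 : (1 : ℝ) ≤ (N : ℝ) ^ I.a := Real.one_le_rpow hN1 (by linarith)
    linarith
  rw [Nat.cast_sum]
  refine (Finset.sum_le_card_nsmul _ _ _ hterm).trans_eq ?_
  rw [Finset.card_range, nsmul_eq_mul, Real.rpow_add_one (by positivity)]
  ring

lemma exists_complexity (hP : P.Assumptions) (hI : I.Valid) :
    ∃ C : ℝ, ∀ ε : ℝ, 0 < ε → ε ≤ 1 →
      ∃ N : ℕ, (N : ℝ) ≤ C * ε ^ (-2 : ℝ) ∧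
        (∀ K : ℕ, N ≤ K → Admissible P K ∧ bestResidual P I K ^ 2 ≤ ε) ∧
        ((∑ k ∈ Finset.range N, I.J k : ℕ) : ℝ) ≤ C * ε ^ (-2 * I.a - 2) := by
  obtain ⟨C, hC⟩ := exists_bestResidual_sq_le hP hI
  have hLf := hP.Lf_pos
  have ha := hI.two_le_a
  -- the three terms of `A` give accuracy, admissibility and `A ≥ 1`
  set A : ℝ := C ^ 2 + (2 * P.Lf) ^ 2 + 1 with hA
  have hA1 : 1 ≤ A := by rw [hA]; nlinarith [sq_nonneg C, sq_nonneg (2 * P.Lf)]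
  refine ⟨max (A + 1) (2 * (A + 1) ^ (I.a + 1)), fun ε hε hε1 => ?_⟩
  have hε2 : 1 ≤ ε ^ (-2 : ℝ) := Real.one_le_rpow_of_pos_of_le_one_of_nonpos hε hε1 (by norm_num)
  have hN1 : 1 ≤ ⌈A * ε ^ (-2 : ℝ)⌉₊ := Nat.one_le_ceil_iff.2 (by positivity)
  have hNle : (⌈A * ε ^ (-2 : ℝ)⌉₊ : ℝ) ≤ (A + 1) * ε ^ (-2 : ℝ) := by
    have := (Nat.ceil_lt_add_one (show 0 ≤ A * ε ^ (-2 : ℝ) by positivity)).le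
    linarith
  refine ⟨⌈A * ε ^ (-2 : ℝ)⌉₊, ?_, fun K hK => ?_, ?_⟩
  · exact hNle.trans (mul_le_mul_of_nonneg_right (le_max_left _ _) (by positivity))
  · have hKA : A * ε ^ (-2 : ℝ) ≤ K := (Nat.le_ceil _).trans (by exact_mod_cast hK)
    have hK0 : (0 : ℝ) < K := lt_of_lt_of_le (by positivity) hKA
    have hKA' : A ≤ K := (le_mul_of_one_le_right (by linarith) hε2).trans hKA
    have hadm : Admissible P K := by
      refine ⟨hN1.trans hK, one_div_le_one_div_of_le (by positivity) (Real.le_sqrt_of_sq_le ?_)⟩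
      nlinarith [sq_nonneg C]
    refine ⟨hadm, (hC K hadm).trans ?_⟩
    have h1 : C / ε ≤ Real.sqrt K := by
      apply Real.le_sqrt_of_sq_le
      refine le_trans ?_ hKA
      rw [div_pow, div_eq_mul_inv, Real.rpow_neg hε.le, Real.rpow_two]
      gcongr
      nlinarith [sq_nonneg (2 * P.Lf)]
    rw [mul_one_div, div_le_iff₀ (by positivity)]
    rwa [div_le_iff₀ hε, mul_comm] at h1
  · have hpow : (ε ^ (-2 : ℝ)) ^ (I.a + 1) = ε ^ (-2 * I.a - 2) := by
      rw [← Real.rpow_mul hε.le]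
      congr 1
      ring
    calc _ ≤ 2 * ((⌈A * ε ^ (-2 : ℝ)⌉₊ : ℕ) : ℝ) ^ (I.a + 1) := sum_J_le hI hN1
      _ ≤ 2 * ((A + 1) * ε ^ (-2 : ℝ)) ^ (I.a + 1) := by
        gcongr
      _ = 2 * (A + 1) ^ (I.a + 1) * ε ^ (-2 * I.a - 2) := by
        rw [Real.mul_rpow (by positivity) (by positivity), hpow, mul_assoc]
      _ ≤ _ := mul_le_mul_of_nonneg_right (le_max_right _ _) (by positivity)

end Bilevel

theorem mainTheorem6 {n : ℕ} (P : Bilevel.Problem n) (hP : P.Assumptions)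
    (I : Bilevel.Input n) (hI : I.Valid) :
    -- the constants exist, independently of the number `K` of outer iterations
    (I.box ⊆ P.dom →
      ∃ c : Bilevel.Consts, ∀ K : ℕ, Bilevel.Admissible P K → c.Bounds P I K) ∧
    -- (i) infeasibility bound, explicit
    (∀ K : ℕ, Bilevel.Admissible P K → 2 ≤ K → Bilevel.LargeEnough P I K →
      ∀ c : Bilevel.Consts, c.Bounds P I K →
        Metric.infDist (Bilevel.xhat P I K K) P.sol ≤
          4 * Real.sqrt (P.α⁻¹ * (c.M1 + c.M2 + c.M3)) *
            (I.a * Real.log K / (K : ℝ) ^ I.a)) ∧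
    -- (i) infeasibility rate
    (∃ C : ℝ, ∀ K : ℕ, Bilevel.Admissible P K → 2 ≤ K →
      Metric.infDist (Bilevel.xhat P I K K) P.sol ≤ C * (Real.log K / (K : ℝ) ^ I.a)) ∧
    -- (ii) residual mapping bound, explicit
    (∀ K : ℕ, Bilevel.Admissible P K → 6 ≤ K → Bilevel.LargeEnough P I K →
      ∀ c : Bilevel.Consts, c.Bounds P I K →
        Bilevel.bestResidual P I K ^ 2 ≤
          8 * (c.Dhat - ⨅ x, P.f x) / Real.sqrt K + 2 * P.Lf * c.Bhat ^ 2 / Real.sqrt K +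
            320 * (Bilevel.cE P I c K + Bilevel.cDelta P I c K) * (3 : ℝ) ^ I.a /
              (P.Lf * (I.a - 1)) * (1 / (K : ℝ) ^ (I.a - 3 / 2))) ∧
    -- (ii) residual mapping rate
    (∃ C : ℝ, ∀ K : ℕ, Bilevel.Admissible P K → 2 ≤ K →
      Bilevel.bestResidual P I K ^ 2 ≤
        C * (1 / Real.sqrt K + Real.log K ^ 2 / (K : ℝ) ^ (I.a - 3 / 2))) ∧
    -- (iii) total iteration complexity
    (∃ C : ℝ, ∀ ε : ℝ, 0 < ε → ε ≤ 1 →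
      ∃ N : ℕ, (N : ℝ) ≤ C * ε ^ (-2 : ℝ) ∧
        (∀ K : ℕ, N ≤ K → Bilevel.Admissible P K ∧ Bilevel.bestResidual P I K ^ 2 ≤ ε) ∧
        ((∑ k ∈ Finset.range N, I.J k : ℕ) : ℝ) ≤ C * ε ^ (-2 * I.a - 2)) := by
  refine ⟨Bilevel.exists_bounds hP hI, ?_, ?_, ?_, ?_, Bilevel.exists_complexity hP hI⟩
  · intro K _ hK hlarge c hc
    obtain ⟨k, rfl⟩ : ∃ k, K = k + 1 := Nat.exists_eq_add_of_le' (by omega)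
    have h := Bilevel.infDist_xhat_succ_le hP hI hc (k := k) (by omega) (by omega)
      (hlarge.eta_le hP hI hK (by omega))
    push_cast
    exact h
  · obtain ⟨C, hC⟩ := Bilevel.exists_infDist_xhat_le hP hI
    exact ⟨C, fun K _ hK => hC K hK⟩
  · intro K hK hK6 hlarge c hc
    exact Bilevel.bestResidual_sq_le_explicit hP hI hK hK6 hlarge hc
  · obtain ⟨C, hC⟩ := Bilevel.exists_bestResidual_sq_le hP hI
    refine ⟨|C|, fun K hK _ => (hC K hK).trans ?_⟩
    have h1 : 0 ≤ Real.log K ^ 2 / (K : ℝ) ^ (I.a - 3 / 2) := by positivity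
    have h2 : C * (1 / Real.sqrt K) ≤ |C| * (1 / Real.sqrt K) :=
      mul_le_mul_of_nonneg_right (le_abs_self C) (by positivity)
    exact h2.trans (mul_le_mul_of_nonneg_left (le_add_of_nonneg_right h1) (abs_nonneg C))
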